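/- Let $M$ be a smooth finite-dimensional manifold (without boundary), let $T_2$ be a smooth pseudo-Riemannian metric on $M$ and let $\alpha$ be a smooth horizontal 1-form on $TM$ (that is, $\alpha$ annihilates the vectors tangent to the fibres of $\pi\colon TM\to M$). The triple $(M,T_2,\alpha)$ is called a mechanical system with work form $\alpha$. Let $\theta$ be the 1-form on $TM$ given by $\theta_v=\pi^*(i_vT_2)$, put $\omega_2=d\theta$ and $T(v)=\tfrac12T_2(v,v)$. The equation of motion of the system is the second order differential equation $D$ (a smooth vector field on $TM$ with $\pi_*D_v=v$ for all $v\in TM$) determined by Newton's equation $i_D\omega_2+dT+\alpha=0$. A smooth vector field $u$ on an open set $O\subseteq M$ is an intermediate integral of the system if $D$ is tangent to the section $u\colon O\to TM$, and it is Lagrangian if $u^*\omega_2=0$. The system is conservative on an open set $O\subseteq M$ if $\alpha=dU$ on $\pi^{-1}(O)$ for some $U\in C^\infty(\pi^{-1}(O))$; it is conservative if this holds for $O=M$, and locally conservative if every point of $M$ has an open neighbourhood on which it is conservative. Suppose that $\alpha$ does not depend on the velocities, i.e. that $\alpha=\pi^*a$ for a smooth 1-form $a$ on $M$. Then: 1.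 $(M,T_2,\alpha)$ is locally conservative if and only if it admits a family of local Lagrangian intermediate integrals whose domains cover $M$. 2. If $(M,T_2,\alpha)$ is conservative, it admits a family of local Lagrangian intermediate integrals whose domains cover $M$. 3. If every smooth closed 1-form on $M$ is exact, i.e. $H^1_{dR}(M)=0$, then $(M,T_2,\alpha)$ is conservative if and only if it admits a family of local Lagrangian intermediate integrals whose domains cover $M$. 4. If $(M,T_2,\alpha)$ admits a Lagrangian intermediate integral defined on the whole of $M$, then it is conservative. -/

import Mathlib

open Set Bundle Topology
open scoped Manifold ContDiff

universe u v

noncomputable section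

namespace Mechanics

section Forms

variable {F : Type*} [NormedAddCommGroup F] [NormedSpace ℝ F]
  {H : Type*} [TopologicalSpace H] (I : ModelWithCorners ℝ F H)
  {N : Type*} [TopologicalSpace N] [ChartedSpace H N]

/-- A (not necessarily smooth) differential 1-form on the manifold `N`. -/
abbrev OneForm : Type _ := (x : N) → (TangentSpace I x →L[ℝ] ℝ)

/-- Smoothness of a 1-form, as a section of the cotangent bundle. -/
def OneForm.IsSmooth [IsManifold I ∞ N] (β : OneForm I (N := N)) : Prop :=
  ContMDiff I (I.prod 𝓘(ℝ, F →L[ℝ] ℝ)) ∞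
    (fun x : N => (TotalSpace.mk' (F →L[ℝ] ℝ) x (β x) :
      TotalSpace (F →L[ℝ] ℝ) (fun x : N => TangentSpace I x →L[ℝ] Trivial N ℝ x)))

/-- The coordinate expression of the 1-form `β` in the preferred chart at `x`: its pull-back to
the model vector space by the inverse of the chart. -/
def OneForm.inChart (β : OneForm I (N := N)) (x : N) (y : F) : F →L[ℝ] ℝ :=
  (β ((extChartAt I x).symm y)).comp (mfderiv 𝓘(ℝ, F) I (extChartAt I x).symm y)

/-- The exterior derivative `dβ` of a 1-form on a manifold without boundary, computed in the
preferred chart at `x`, with the convention `dβ(X, Y) = X(β(Y)) - Y(β(X)) - β([X, Y])`. -/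
def OneForm.extDeriv (β : OneForm I (N := N)) (x : N) (ξ η : TangentSpace I x) : ℝ :=
  fderiv ℝ (β.inChart I x) (extChartAt I x x)
      (mfderiv I 𝓘(ℝ, F) (extChartAt I x) x ξ) (mfderiv I 𝓘(ℝ, F) (extChartAt I x) x η)
    - fderiv ℝ (β.inChart I x) (extChartAt I x x)
      (mfderiv I 𝓘(ℝ, F) (extChartAt I x) x η) (mfderiv I 𝓘(ℝ, F) (extChartAt I x) x ξ)

/-- The 1-form `df`. -/
def differential (f : N → ℝ) : OneForm I (N := N) := fun x => mfderiv I 𝓘(ℝ, ℝ) f x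

variable (N) in
/-- The first de Rham cohomology of `N` vanishes: every smooth closed 1-form on `N` is the
differential of a smooth function. -/
def FirstDeRhamCohomologyVanishes [IsManifold I ∞ N] : Prop :=
  ∀ β : OneForm I (N := N), β.IsSmooth I → (∀ x ξ η, β.extDeriv I x ξ η = 0) →
    ∃ f : N → ℝ, ContMDiff I 𝓘(ℝ, ℝ) ∞ f ∧ β = differential I f

end Forms

variable (E : Type v) [NormedAddCommGroup E] [NormedSpace ℝ E]
  (M : Type u) [TopologicalSpace M] [ChartedSpace E M] [IsManifold 𝓘(ℝ, E) ∞ M]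

/-- The tangent bundle `TM`. -/
abbrev TM : Type _ := TangentBundle 𝓘(ℝ, E) M

/-- The model with corners (without boundary) of the manifold `TM`. -/
abbrev JT : ModelWithCorners ℝ (E × E) (ModelProd E E) := (𝓘(ℝ, E)).tangent

/-- A smooth pseudo-Riemannian metric on `M`: a smooth field of nondegenerate symmetric bilinear
forms, of arbitrary signature. -/
structure PseudoRiemannianMetric where
  /-- The bilinear form on each tangent space. -/
  form : (x : M) → (TangentSpace 𝓘(ℝ, E) x →L[ℝ] TangentSpace 𝓘(ℝ, E) x →L[ℝ] ℝ)
  symm : ∀ x v w, form x v w = form x w v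
  nondegenerate : ∀ x v, (∀ w, form x v w = 0) → v = 0
  smooth : ContMDiff 𝓘(ℝ, E) (𝓘(ℝ, E).prod 𝓘(ℝ, E →L[ℝ] E →L[ℝ] ℝ)) ∞
    (fun x : M => (TotalSpace.mk' (E →L[ℝ] E →L[ℝ] ℝ) x (form x) :
      TotalSpace (E →L[ℝ] E →L[ℝ] ℝ) (fun x : M =>
        TangentSpace 𝓘(ℝ, E) x →L[ℝ] TangentSpace 𝓘(ℝ, E) x →L[ℝ] Trivial M ℝ x)))

variable {E M}

/-- The differential `π_*` at `p ∈ TM` of the projection `π : TM → M`. -/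
def projDeriv (p : TM E M) : TangentSpace (JT E) p →L[ℝ] TangentSpace 𝓘(ℝ, E) p.proj :=
  mfderiv (JT E) 𝓘(ℝ, E) (fun q : TM E M => q.proj) p

/-- A 1-form on `TM` is horizontal if it annihilates the vertical vectors. -/
def IsHorizontal (α : OneForm (JT E) (N := TM E M)) : Prop :=
  ∀ (p : TM E M) (ξ : TangentSpace (JT E) p), projDeriv p ξ = 0 → α p ξ = 0

variable (E M) in
/-- A classical mechanical system `(M, T₂, α)`: a manifold with a pseudo-Riemannian metric `T₂`
and a smooth horizontal 1-form `α` on `TM`, the work form. -/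
structure MechanicalSystem where
  /-- The metric `T₂`. -/
  metric : PseudoRiemannianMetric E M
  /-- The work form `α`. -/
  work : OneForm (JT E) (N := TM E M)
  work_smooth : work.IsSmooth (JT E)
  work_horizontal : IsHorizontal work

namespace PseudoRiemannianMetric

variable (g : PseudoRiemannianMetric E M)

/-- The Liouville form `θ` transported to `TM` by the metric: `θ_v = i_v T₂`, pulled back
by `π`. -/
def liouville : OneForm (JT E) (N := TM E M) :=
  fun p => (g.form p.proj p.snd).comp (projDeriv p)

/-- The symplectic form `ω₂ = dθ` on `TM`. -/
def symplecticForm (p : TM E M) (ξ η : TangentSpace (JT E) p) : ℝ :=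
  g.liouville.extDeriv (JT E) p ξ η

/-- The kinetic energy `T(v) = T₂(v, v) / 2`. -/
def kineticEnergy (p : TM E M) : ℝ := (1 / 2 : ℝ) * g.form p.proj p.snd p.snd

end PseudoRiemannianMetric

/-- A second order differential equation on `M`: a smooth vector field `D` on `TM` such that
`π_*(D_v) = v` for all `v ∈ TM`. -/
def IsSecondOrderEquation (D : (p : TM E M) → TangentSpace (JT E) p) : Prop :=
  ContMDiff (JT E) (JT E).tangent ∞
      (fun p : TM E M => (⟨p, D p⟩ : TangentBundle (JT E) (TM E M))) ∧
    ∀ p : TM E M, projDeriv p (D p) = p.snd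

/-- The section of `TM` defined by a vector field on `M`. -/
def toSection (X : (x : M) → TangentSpace 𝓘(ℝ, E) x) : M → TM E M := fun x => ⟨x, X x⟩

/-- The differential at `x` of the section of `TM` defined by a vector field on `M`. -/
def sectionDeriv (X : (x : M) → TangentSpace 𝓘(ℝ, E) x) (x : M) :
    TangentSpace 𝓘(ℝ, E) x →L[ℝ] TangentSpace (JT E) (toSection X x) :=
  mfderiv 𝓘(ℝ, E) (JT E) (toSection X) x

namespace MechanicalSystem

variable (S : MechanicalSystem E M)

/-- The work form does not depend on the velocities: it is the pull-back `π^* a` of a 1-form `a`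
on `M`. -/
def VelocityIndependent : Prop :=
  ∃ a : OneForm 𝓘(ℝ, E) (N := M), a.IsSmooth 𝓘(ℝ, E) ∧
    ∀ p : TM E M, S.work p = (a p.proj).comp (projDeriv p)

/-- The system is conservative: its work form is an exact differential. -/
def IsConservative : Prop :=
  ∃ U : TM E M → ℝ, ContMDiff (JT E) 𝓘(ℝ, ℝ) ∞ U ∧ S.work = differential (JT E) U

/-- The system is conservative on the open set `O` of `M`: the work form is an exact differential
over `O`. -/
def IsConservativeOn (O : Set M) : Prop :=
  ∃ U : TM E M → ℝ, ContMDiffOn (JT E) 𝓘(ℝ, ℝ) ∞ U {p | p.proj ∈ O} ∧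
    ∀ p : TM E M, p.proj ∈ O → S.work p = differential (JT E) U p

/-- The system is locally conservative: it is conservative on a neighbourhood of each point. -/
def IsLocallyConservative : Prop :=
  ∀ x : M, ∃ O : Set M, IsOpen O ∧ x ∈ O ∧ S.IsConservativeOn O

/-- `D` is the differential equation of motion of the system: the second order differential
equation satisfying Newton's equation `i_D ω₂ + dT + α = 0`. -/
def IsEquationOfMotion (D : (p : TM E M) → TangentSpace (JT E) p) : Prop :=
  IsSecondOrderEquation D ∧
    ∀ (p : TM E M) (ξ : TangentSpace (JT E) p),
      S.metric.symplecticForm p (D p) ξ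
        + differential (JT E) S.metric.kineticEnergy p ξ + S.work p ξ = 0

/-- The vector field `X`, defined on the open set `O`, is an intermediate integral of the system:
`X` is smooth on `O` and the equation of motion is tangent to the section of `TM` over `O`
defined by `X`. -/
def IsIntermediateIntegralOn (O : Set M) (X : (x : M) → TangentSpace 𝓘(ℝ, E) x) : Prop :=
  IsOpen O ∧ ContMDiffOn 𝓘(ℝ, E) (JT E) ∞ (toSection X) O ∧
    ∃ D : (p : TM E M) → TangentSpace (JT E) p, S.IsEquationOfMotion D ∧
      ∀ x ∈ O, ∃ w : TangentSpace 𝓘(ℝ, E) x, sectionDeriv X x w = D (toSection X x)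

/-- The vector field `X` on the open set `O` is Lagrangian: the pull-back to `O` of the symplectic
form by the section of `TM` defined by `X` vanishes. -/
def IsLagrangianOn (O : Set M) (X : (x : M) → TangentSpace 𝓘(ℝ, E) x) : Prop :=
  ∀ x ∈ O, ∀ v w : TangentSpace 𝓘(ℝ, E) x,
    S.metric.symplecticForm (toSection X x) (sectionDeriv X x v) (sectionDeriv X x w) = 0

/-- The system admits a family of local Lagrangian intermediate integrals whose domains
cover `M`. -/
def AdmitsLagrangianIntermediateIntegrals : Prop :=
  ∃ (ι : Type u) (O : ι → Set M) (X : ι → (x : M) → TangentSpace 𝓘(ℝ, E) x),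
    (⋃ i, O i) = univ ∧
      ∀ i, S.IsIntermediateIntegralOn (O i) (X i) ∧ S.IsLagrangianOn (O i) (X i)

end MechanicalSystem

end Mechanics

end

/-! Write $\alpha=\pi^*a$ and let $u$ be a vector field on an open set, seen as a section of $TM$.
Pulling Newton's equation back by $u$ gives $u^*(i_D\omega_2)+d(T\circ u)+a=0$. If $D$ is tangent to
the section and $u^*\omega_2=0$, the first term vanishes, so $a=-d(T\circ u)$: a Lagrangian
intermediate integral provides a potential on its domain (`IsLagrangianOn.exists_eq_differential`).
This gives statement 4 and one half of statement 1. Under $H^1_{dR}(M)=0$ the local potentials show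
that $a$ is closed, hence exact.

Conversely let $a=df$ near a point, and let $S$ solve the Hamilton–Jacobi equation $\tfrac12
g^{-1}(dS,dS)+f=k$ there. For $u=\operatorname{grad}S$ one has $u^*\theta=dS$, so $u$ is Lagrangian,
and $T\circ u+f$ is constant, so $u^*(i_D\omega_2)=0$. Then $u_*u-D$ is vertical and
$\omega_2$-orthogonal to the section, hence zero by nondegeneracy of the metric
(`eq_zero_of_vertical`), and $D$ is tangent to the section
(`exists_isLagrangianOn_of_eq_differential`).

Local solutions of the Hamilton–Jacobi equation come from the method of characteristics: initial
data on a hyperplane are carried along by the characteristic flow, and $S$ is the action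
(`exists_local_solution_hamiltonJacobi`). This needs a flow smooth in time and initial value
together, obtained from the implicit function theorem in the Banach space of curves $C([0,1],A)$
(`exists_smooth_flow`). The field $D$ itself is solved for in the charts of $TM$ and glued by
uniqueness. -/

namespace Mechanics

/-! ### Smoothness of composition operators on spaces of continuous maps. -/

section Superposition

variable {K : Type*} [TopologicalSpace K] [CompactSpace K]
  {A : Type u} [NormedAddCommGroup A] [NormedSpace ℝ A]

/-- The superposition operator `γ ↦ f ∘ γ` on continuous maps. -/
def superposition {B : Type*} [TopologicalSpace B] (f : A → B) (hf : Continuous f)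
    (γ : C(K, A)) : C(K, B) :=
  (⟨f, hf⟩ : C(A, B)).comp γ

set_option synthInstance.maxHeartbeats 400000 in
/-- Pointwise application of a continuous family of continuous linear maps, as a continuous
bilinear map. -/
noncomputable def pointwiseApply (K : Type*) [TopologicalSpace K] [CompactSpace K]
    (A B : Type*) [NormedAddCommGroup A] [NormedSpace ℝ A]
    [NormedAddCommGroup B] [NormedSpace ℝ B] : C(K, A →L[ℝ] B) →L[ℝ] C(K, A) →L[ℝ] C(K, B) :=
  LinearMap.mkContinuous₂
    (LinearMap.mk₂ ℝ (fun (T : C(K, A →L[ℝ] B)) (γ : C(K, A)) =>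
        (⟨fun s => T s (γ s), by fun_prop⟩ : C(K, B)))
      (fun _ _ _ => by ext; simp) (fun _ _ _ => by ext; simp)
      (fun _ _ _ => by ext; simp) (fun _ _ _ => by ext; simp)) 1 (fun T γ => by
        refine (ContinuousMap.norm_le _ (by positivity)).2 fun s => ?_
        rw [one_mul]
        exact ((T s).le_opNorm (γ s)).trans
          (mul_le_mul (T.norm_coe_le_norm s) (γ.norm_coe_le_norm s) (by positivity)
            (by positivity)))

-- The remainder at each `s` is controlled by the mean value inequality on a ball around `γ s`.
-- Compactness of `K` makes the radius uniform in `s`, although `fderiv ℝ f` need not be uniformly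
-- continuous on `A`.
set_option synthInstance.maxHeartbeats 400000 in
theorem hasFDerivAt_superposition {B : Type*} [NormedAddCommGroup B] [NormedSpace ℝ B]
    {f : A → B} (hf : ContDiff ℝ 1 f) (γ : C(K, A)) :
    HasFDerivAt (superposition (K := K) f hf.continuous)
      (pointwiseApply K A B (superposition (fderiv ℝ f) (hf.continuous_fderiv one_ne_zero) γ))
      γ := by
  have hcont := hf.continuous_fderiv one_ne_zero
  refine .of_isLittleO (Asymptotics.isLittleO_iff.2 fun ε hε => ?_)
  have key : ∀ᶠ v : A in 𝓝 0, ∀ s ∈ (univ : Set K),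
      ‖fderiv ℝ f (γ s + v) - fderiv ℝ f (γ s)‖ < ε := by
    refine isCompact_univ.eventually_forall_of_forall_eventually fun s _ => ?_
    have hc : Continuous fun z : A × K =>
        ‖fderiv ℝ f (γ z.2 + z.1) - fderiv ℝ f (γ z.2)‖ := by fun_prop
    exact hc.continuousAt.eventually_lt continuousAt_const (by simpa using hε)
  obtain ⟨δ, hδ, hball⟩ := Metric.eventually_nhds_iff_ball.1 key
  filter_upwards [Metric.ball_mem_nhds γ hδ] with η hη
  refine (ContinuousMap.norm_le _ (by positivity)).2 fun s => ?_
  have hs : η s ∈ Metric.ball (γ s) δ :=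
    lt_of_le_of_lt (ContinuousMap.dist_apply_le_dist s) hη
  have h := Convex.norm_image_sub_le_of_norm_hasFDerivWithin_le' (𝕜 := ℝ) (f := f)
    (f' := fderiv ℝ f) (φ := fderiv ℝ f (γ s)) (C := ε) (s := Metric.ball (γ s) δ)
    (fun a _ => ((hf.differentiable one_ne_zero) a).hasFDerivAt.hasFDerivWithinAt)
    (fun a ha => by
      have := hball (a - γ s) (by simpa [dist_eq_norm] using ha) s (mem_univ s)
      rw [add_sub_cancel] at this
      exact this.le) (convex_ball _ _) (Metric.mem_ball_self hδ) hs
  exact h.trans (mul_le_mul_of_nonneg_left ((η - γ).norm_coe_le_norm s) hε.le)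

-- The derivative is again a superposition operator, that of `fderiv ℝ f`, followed by the bounded
-- linear map `pointwiseApply`. Its target is `A →L[ℝ] B`, so the induction must range over all `B`,
-- in a universe closed under this step.
set_option synthInstance.maxHeartbeats 400000 in
theorem contDiff_nat_superposition (n : ℕ) : ∀ {B : Type u} [NormedAddCommGroup B]
    [NormedSpace ℝ B] {f : A → B} (hf : ContDiff ℝ n f),
    ContDiff ℝ n (superposition (K := K) f hf.continuous) := by
  induction n with
  | zero =>
    intro B _ _ f hf
    exact contDiff_zero.2 (ContinuousMap.continuous_postcomp _)
  | succ n ih =>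
    intro B _ _ f hf
    have h1 : ContDiff ℝ 1 f := hf.of_le (by exact_mod_cast Nat.le_add_left 1 n)
    have h2 : ContDiff ℝ n (fderiv ℝ f) := hf.fderiv_right (by push_cast; rfl)
    push_cast
    exact contDiff_succ_iff_hasFDerivAt.2
      ⟨_, (pointwiseApply K A B).contDiff.comp (ih h2), hasFDerivAt_superposition h1⟩

theorem contDiff_superposition {B : Type u} [NormedAddCommGroup B] [NormedSpace ℝ B]
    {f : A → B} (hf : ContDiff ℝ ∞ f) :
    ContDiff ℝ ∞ (superposition (K := K) f hf.continuous) :=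
  contDiff_infty.2 fun n => contDiff_nat_superposition n (contDiff_infty.1 hf n)

end Superposition

/-! ### Smooth flows of autonomous equations. -/

section Flow

variable {A : Type u} [NormedAddCommGroup A] [NormedSpace ℝ A]

/-- The primitive vanishing at `0` of a continuous curve defined on the unit interval. -/
noncomputable def primitive (A : Type*) [NormedAddCommGroup A] [NormedSpace ℝ A] :
    C(unitInterval, A) →L[ℝ] C(unitInterval, A) :=
  LinearMap.mkContinuous
    { toFun := fun γ => ⟨fun s => ∫ r in (0 : ℝ)..s, IccExtend zero_le_one γ r,
        (intervalIntegral.continuous_primitive (fun _ _ =>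
          (γ.continuous.Icc_extend' (h := zero_le_one)).intervalIntegrable _ _) 0).comp
          continuous_subtype_val⟩
      map_add' := fun γ η => by
        ext s
        exact intervalIntegral.integral_add
          ((γ.continuous.Icc_extend' (h := zero_le_one)).intervalIntegrable _ _)
          ((η.continuous.Icc_extend' (h := zero_le_one)).intervalIntegrable _ _)
      map_smul' := fun c γ => by
        ext s
        exact intervalIntegral.integral_smul c _ } 1 (fun γ => by
      refine (ContinuousMap.norm_le _ (by positivity)).2 fun s => ?_
      rw [one_mul]
      refine (intervalIntegral.norm_integral_le_of_norm_le_const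
        (C := ‖γ‖) fun r _ => γ.norm_coe_le_norm _).trans ?_
      have : |(s : ℝ) - 0| ≤ 1 := by
        rw [sub_zero, abs_of_nonneg s.2.1]; exact s.2.2
      exact mul_le_of_le_one_right (norm_nonneg _) this)

theorem primitive_apply (γ : C(unitInterval, A)) (s : unitInterval) :
    primitive A γ s = ∫ r in (0 : ℝ)..s, IccExtend zero_le_one γ r := rfl

/-- The restriction `r ↦ γ (s r)` of a curve to a smaller interval, reparametrized. -/
def rescale (s : unitInterval) (γ : C(unitInterval, A)) : C(unitInterval, A) :=
  γ.comp ⟨fun r => s * r, by fun_prop⟩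

theorem primitive_rescale (s : unitInterval) (γ : C(unitInterval, A)) (r : unitInterval) :
    (s : ℝ) • primitive A (rescale s γ) r = primitive A γ (s * r) := by
  rw [primitive_apply, primitive_apply]
  have h := intervalIntegral.smul_integral_comp_mul_left (a := 0) (b := r)
    (IccExtend zero_le_one γ) (s : ℝ)
  rw [mul_zero] at h
  rw [Icc.coe_mul, ← h]
  congr 1
  refine intervalIntegral.integral_congr fun x hx => ?_
  rw [uIcc_of_le r.2.1] at hx
  have hx1 : x ∈ Icc (0 : ℝ) 1 := ⟨hx.1, hx.2.trans r.2.2⟩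
  have hx2 : (s : ℝ) * x ∈ Icc (0 : ℝ) 1 := unitInterval.mul_mem s.2 hx1
  rw [IccExtend_of_mem _ _ hx1, IccExtend_of_mem _ _ hx2]
  rfl

end Flow

section Flow

variable {A : Type u} [NormedAddCommGroup A] [NormedSpace ℝ A]

/-- The constant curves, as a continuous linear map. -/
noncomputable def constCurve (A : Type*) [NormedAddCommGroup A] [NormedSpace ℝ A] :
    A →L[ℝ] C(unitInterval, A) :=
  LinearMap.mkContinuous
    { toFun := fun a => ContinuousMap.const _ a
      map_add' := fun _ _ => rfl
      map_smul' := fun _ _ => rfl } 1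
    (fun a => (ContinuousMap.norm_le _ (by positivity)).2 fun _ => (one_mul ‖a‖).ge)

/-- The zeros of this map are the curves `γ` with `γ' = t f(γ)` and `γ 0 = x`. -/
noncomputable def integralEquation (f : A → A) (hf : Continuous f)
    (u : (ℝ × A) × C(unitInterval, A)) : C(unitInterval, A) :=
  u.2 - constCurve A u.1.2 - u.1.1 • primitive A (superposition f hf u.2)

theorem integralEquation_eq_zero_iff {f : A → A} {hf : Continuous f} {t : ℝ} {x : A}
    {γ : C(unitInterval, A)} : integralEquation f hf ((t, x), γ) = 0 ↔
      ∀ s, γ s = x + t • primitive A (superposition f hf γ) s := by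
  rw [integralEquation, sub_sub, sub_eq_zero, DFunLike.ext_iff]
  rfl

/-- All curves live on the unit interval, with the time `t` as a factor of the vector field. Running
a solution only up to the fraction `s` therefore solves the problem for the time `s * t`; this is
how the parameter `t` becomes the time of the flow. -/
theorem integralEquation_rescale {f : A → A} {hf : Continuous f} {t : ℝ} {x : A}
    {γ : C(unitInterval, A)} (h : integralEquation f hf ((t, x), γ) = 0) (s : unitInterval) :
    integralEquation f hf ((s * t, x), rescale s γ) = 0 := by
  rw [integralEquation_eq_zero_iff] at h ⊢
  intro r
  have h1 : superposition f hf (rescale s γ) = rescale s (superposition f hf γ) := rfl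
  rw [h1, mul_comm, mul_smul, primitive_rescale, ← h (s * r)]
  rfl

theorem contDiff_integralEquation {f : A → A} (hf : ContDiff ℝ ∞ f) :
    ContDiff ℝ ∞ (integralEquation f hf.continuous) := by
  have h := contDiff_superposition (K := unitInterval) hf
  unfold integralEquation
  exact (contDiff_snd.sub ((constCurve A).contDiff.comp (contDiff_snd.comp contDiff_fst))).sub
    ((contDiff_fst.comp contDiff_fst).smul
      ((primitive A).contDiff.comp (h.comp contDiff_snd)))

/-- At `t = 0` the nonlinear term disappears and the equation is affine in the curve, with linear
part the identity. The implicit function theorem thus applies at constant curves. -/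
theorem fderiv_integralEquation_comp_inr {f : A → A} (hf : ContDiff ℝ ∞ f) (x : A)
    (γ : C(unitInterval, A)) :
    (fderiv ℝ (integralEquation f hf.continuous) ((0, x), γ)) ∘L
      .inr ℝ (ℝ × A) C(unitInterval, A) = .id ℝ _ := by
  have h1 : HasFDerivAt (fun η => integralEquation f hf.continuous ((0, x), η)) _ γ :=
    (((contDiff_integralEquation hf).differentiable (by simp) ((0, x), γ)).hasFDerivAt).comp γ
      (hasFDerivAt_prodMk_right (0, x) γ)
  have h2 : HasFDerivAt (fun η => integralEquation f hf.continuous ((0, x), η)) (.id ℝ _) γ := by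
    simp only [integralEquation, zero_smul, sub_zero]
    exact (hasFDerivAt_id γ).sub_const _
  exact h1.unique h2

/-- The implicit function theorem for smooth functions: the implicit function is smooth on a
neighbourhood of the base point. -/
theorem exists_smooth_implicit {B C : Type*} [NormedAddCommGroup B] [NormedSpace ℝ B]
    [NormedAddCommGroup C] [NormedSpace ℝ C] [CompleteSpace A] [CompleteSpace B]
    [CompleteSpace C] {f : A × B → C}
    {u : A × B} (hf : ∀ᶠ v in 𝓝 u, ContDiffAt ℝ ∞ f v)
    (hinv : (fderiv ℝ f u ∘L .inr ℝ A B).IsInvertible) :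
    ∃ Γ : A → B, Γ u.1 = u.2 ∧ (∀ᶠ a in 𝓝 u.1, ContDiffAt ℝ ∞ Γ a) ∧
      (∀ᶠ a in 𝓝 u.1, f (a, Γ a) = f u) ∧ ∀ᶠ v in 𝓝 u, f v = f u ↔ Γ v.1 = v.2 := by
  have hfu := hf.self_of_nhds
  have hsm := hfu.contDiffAt_implicitFunction (by simp) hinv
  have hbase := hfu.implicitFunction_apply_self (by simp) hinv
  have hex := hfu.eventually_apply_implicitFunction (by simp) hinv
  have huniq := hfu.eventually_apply_eq_iff_implicitFunction (by simp) hinv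
  set Γ := hfu.implicitFunction (by simp) hinv
  refine ⟨Γ, hbase, ?_, hex, huniq⟩
  -- Smoothness of order `∞` at the base point alone allows neighbourhoods shrinking with the order.
  -- So the theorem is applied anew at each nearby point of the graph, where the partial derivative
  -- is still invertible, and local uniqueness identifies the new implicit function `Γ'` with `Γ`.
  have hinv' : ∀ᶠ v in 𝓝 u, (fderiv ℝ f v ∘L .inr ℝ A B).IsInvertible := by
    obtain ⟨e, he⟩ := hinv
    have hc : ContinuousAt (fun v => fderiv ℝ f v ∘L .inr ℝ A B) u :=
      ((hfu.continuousAt_fderiv (by simp)).clm_comp continuousAt_const)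
    have hn := ContinuousLinearEquiv.nhds e
    rw [he] at hn
    exact (hc.eventually hn).mono fun v ⟨e', he'⟩ => ⟨e', he'⟩
  have hgraph : Filter.Tendsto (fun a => (a, Γ a)) (𝓝 u.1) (𝓝 u) := by
    have : ContinuousAt (fun a => (a, Γ a)) u.1 := continuousAt_id.prodMk hsm.continuousAt
    rw [ContinuousAt, hbase] at this
    exact this
  filter_upwards [hgraph.eventually (hf.and (hinv'.and huniq.eventually_nhds)), hex]
    with a ⟨hfa, hia, hua⟩ hea
  have hsm' := hfa.contDiffAt_implicitFunction (by simp) hia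
  have hbase' := hfa.implicitFunction_apply_self (by simp) hia
  have hex' := hfa.eventually_apply_implicitFunction (by simp) hia
  set Γ' := hfa.implicitFunction (by simp) hia
  dsimp only at hsm' hbase' hex'
  have hgraph' : Filter.Tendsto (fun a => (a, Γ' a)) (𝓝 a) (𝓝 (a, Γ a)) := by
    have : ContinuousAt (fun a => (a, Γ' a)) a := continuousAt_id.prodMk hsm'.continuousAt
    rw [ContinuousAt, hbase'] at this
    exact this
  refine hsm'.congr_of_eventuallyEq ?_
  filter_upwards [hgraph'.eventually hua, hex'] with b hb hb'
  exact hb.1 (hb'.trans hea)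

/-- Smooth dependence of the solutions of an autonomous equation on time and on the initial
value, for a globally smooth right-hand side. -/
theorem exists_smooth_flow_of_contDiff [CompleteSpace A] {f : A → A} (hf : ContDiff ℝ ∞ f)
    (x₀ : A) :
    ∃ φ : ℝ × A → A, ∀ᶠ z in 𝓝 ((0 : ℝ), x₀), ContDiffAt ℝ ∞ φ z ∧
      HasDerivAt (fun t => φ (t, z.2)) (f (φ z)) z.1 ∧ φ (0, z.2) = z.2 := by
  have hg : ∀ᶠ v in 𝓝 (((0 : ℝ), x₀), constCurve A x₀),
      ContDiffAt ℝ ∞ (integralEquation f hf.continuous) v :=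
    .of_forall fun v => (contDiff_integralEquation hf).contDiffAt
  have hinv : ((fderiv ℝ (integralEquation f hf.continuous) ((0, x₀), constCurve A x₀)) ∘L
      .inr ℝ (ℝ × A) C(unitInterval, A)).IsInvertible := by
    rw [fderiv_integralEquation_comp_inr hf]
    exact ⟨.refl ℝ _, rfl⟩
  have h0 : integralEquation f hf.continuous ((0, x₀), constCurve A x₀) = 0 := by
    rw [integralEquation_eq_zero_iff]
    intro s
    rw [zero_smul, add_zero]
    rfl
  obtain ⟨Γ, hbase, hsm, hex, huniq⟩ := exists_smooth_implicit hg hinv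
  rw [h0] at hex huniq
  dsimp only at hex hsm hbase
  let ev : C(unitInterval, A) →L[ℝ] A := ContinuousMap.evalCLM ℝ 1
  have hφsm : ∀ᶠ z in 𝓝 ((0 : ℝ), x₀), ContDiffAt ℝ ∞ (fun z => Γ z 1) z :=
    hsm.mono fun z hz => ev.contDiff.contDiffAt.comp _ hz
  -- The flow at time `t` is the endpoint of the curve with rescaled time.
  refine ⟨fun z => Γ z 1, ?_⟩
  obtain ⟨ε, hε, huniq⟩ := Metric.eventually_nhds_iff_ball.1 huniq
  have hΓnear : ∀ᶠ z in 𝓝 ((0 : ℝ), x₀), Γ z ∈ Metric.ball (constCurve A x₀) ε := by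
    refine hsm.self_of_nhds.continuousAt.eventually (Metric.isOpen_ball.mem_nhds ?_)
    rw [hbase]
    exact Metric.mem_ball_self hε
  obtain ⟨δ, hδ, hall⟩ := Metric.eventually_nhds_iff_ball.1
    ((hex.and (hΓnear.and hφsm)).and (Metric.ball_mem_nhds _ hε))
  have hmem : ∀ {t : ℝ} {x : A} {η : ℝ},
      (t, x) ∈ Metric.ball ((0 : ℝ), x₀) η ↔ |t| < η ∧ dist x x₀ < η := by
    intro t x η
    rw [Metric.mem_ball, Prod.dist_eq, max_lt_iff, Real.dist_0_eq_abs]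
  -- The rescaled curve solves the equation and stays close to the constant curve, so uniqueness in
  -- the implicit function theorem identifies it.
  have hscale : ∀ {t : ℝ} {x : A}, (t, x) ∈ Metric.ball ((0 : ℝ), x₀) δ → ∀ s : unitInterval,
      Γ (s * t, x) = rescale s (Γ (t, x)) := by
    intro t x h s
    obtain ⟨⟨hsol, hnear, -⟩, hz⟩ := hall _ h
    replace hz := hmem.1 (Metric.mem_ball.2 hz)
    refine (huniq ((s * t, x), rescale s (Γ (t, x))) ?_).1 (integralEquation_rescale hsol s)
    rw [Metric.mem_ball, Prod.dist_eq, max_lt_iff]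
    refine ⟨?_, ?_⟩
    · rw [← Metric.mem_ball, hmem]
      refine ⟨lt_of_le_of_lt ?_ hz.1, hz.2⟩
      rw [abs_mul, abs_of_nonneg s.2.1]
      exact mul_le_of_le_one_left (abs_nonneg _) s.2.2
    · rw [Metric.mem_ball, ContinuousMap.dist_lt_iff hε] at hnear
      refine (ContinuousMap.dist_lt_iff hε).2 ?_
      exact fun r => hnear (s * r)
  -- The solution for time `2 * t` passes through the flow at time `t` at the interior parameter `1
  -- / 2`, so a two-sided derivative is available there.
  have hne : ∀ {t : ℝ} {x : A}, (2 * t, x) ∈ Metric.ball ((0 : ℝ), x₀) δ → t ≠ 0 →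
      HasDerivAt (fun t => Γ (t, x) 1) (f (Γ (t, x) 1)) t := by
    intro t x h ht
    obtain ⟨⟨hsol, -, -⟩, -⟩ := hall _ h
    have hval : ∀ {s : ℝ}, s / (2 * t) ∈ Icc (0 : ℝ) 1 → Γ (s, x) 1 =
        IccExtend zero_le_one (Γ (2 * t, x)) (s / (2 * t)) := by
      intro s hs
      have := hscale h ⟨_, hs⟩
      dsimp only at this
      rw [div_mul_cancel₀ s (by simpa using ht)] at this
      rw [this, IccExtend_of_mem _ _ hs]
      exact congrArg (Γ (2 * t, x)) (mul_one _)
    have hhalf : t / (2 * t) = 1 / 2 := by field_simp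
    have hloc : ∀ᶠ s in 𝓝 t, s / (2 * t) ∈ Icc (0 : ℝ) 1 := by
      have hc : ContinuousAt (fun s : ℝ => s / (2 * t)) t := by fun_prop
      refine hc.eventually (Icc_mem_nhds ?_ ?_) <;> simp only [hhalf] <;> norm_num
    rw [integralEquation_eq_zero_iff] at hsol
    have hev : (fun s => Γ (s, x) 1) =ᶠ[𝓝 t] fun s => x + (2 * t) •
        ∫ r in (0 : ℝ)..(s / (2 * t)),
          IccExtend zero_le_one (superposition f hf.continuous (Γ (2 * t, x))) r := by
      filter_upwards [hloc] with s hs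
      rw [hval hs, IccExtend_of_mem _ _ hs, hsol]
      rfl
    have hcont := (superposition f hf.continuous (Γ (2 * t, x))).continuous.Icc_extend'
      (h := zero_le_one)
    have hint := (intervalIntegral.integral_hasDerivAt_right
      (hcont.intervalIntegrable 0 (t / (2 * t)))
      hcont.stronglyMeasurable.stronglyMeasurableAtFilter hcont.continuousAt)
    have hcomp := hint.scomp t ((hasDerivAt_id t).div_const (2 * t))
    have hfin := (hcomp.const_smul (2 * t)).const_add x
    refine (hfin.congr_of_eventuallyEq hev).congr_deriv ?_
    rw [hval hloc.self_of_nhds, smul_smul, mul_one_div_cancel (by simpa using ht), one_smul]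
    rfl
  have hnhds : Metric.ball ((0 : ℝ), x₀) (δ / 2) ∈ 𝓝 ((0 : ℝ), x₀) :=
    Metric.ball_mem_nhds _ (half_pos hδ)
  have hdouble : ∀ {t : ℝ} {x : A}, (t, x) ∈ Metric.ball ((0 : ℝ), x₀) (δ / 2) →
      (2 * t, x) ∈ Metric.ball ((0 : ℝ), x₀) δ := by
    intro t x h
    rw [hmem] at h ⊢
    rw [abs_mul, abs_two]
    constructor <;> linarith [h.1, h.2]
  filter_upwards [hnhds] with ⟨t, x⟩ hz
  have hx : (0, x) ∈ Metric.ball ((0 : ℝ), x₀) δ := by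
    rw [hmem] at hz ⊢
    rw [abs_zero]
    constructor <;> linarith [hz.2]
  obtain ⟨⟨hsol, -, hreg⟩, -⟩ := hall _ hx
  refine ⟨(hall _ (Metric.ball_subset_ball (half_le_self hδ.le) hz)).1.2.2, ?_, ?_⟩
  · by_cases ht : t = 0
    -- At `t = 0` the quotient by `2 * t` is unavailable. Both sides of the differential equation
    -- are continuous in time and agree for small `s ≠ 0`, hence also at `0`.
    · subst ht
      have hinc : ∀ s : ℝ, HasDerivAt (fun s : ℝ => (s, x)) ((1 : ℝ), (0 : A)) s := fun s =>
        (hasDerivAt_id s).prodMk (hasDerivAt_const s x)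
      have htend : Filter.Tendsto (fun s : ℝ => (s, x)) (𝓝 0) (𝓝 (0, x)) :=
        (hinc 0).continuousAt
      have hd : ∀ {s : ℝ}, (s, x) ∈ Metric.ball ((0 : ℝ), x₀) δ →
          HasDerivAt (fun s => Γ (s, x) 1) (fderiv ℝ (fun z => Γ z 1) (s, x) (1, 0)) s :=
        fun {s} hs => HasFDerivAt.comp_hasDerivAt (l := fun z => Γ z 1) s
          ((hall _ hs).1.2.2.differentiableAt (by simp)).hasFDerivAt (hinc s)
      have hev : ∀ᶠ s in 𝓝[≠] (0 : ℝ),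
          fderiv ℝ (fun z => Γ z 1) (s, x) (1, 0) = f (Γ (s, x) 1) := by
        have h1 : ∀ᶠ s in 𝓝[≠] (0 : ℝ), (s, x) ∈ Metric.ball ((0 : ℝ), x₀) (δ / 2) :=
          (htend.eventually (Metric.isOpen_ball.mem_nhds hz)).filter_mono nhdsWithin_le_nhds
        filter_upwards [h1, self_mem_nhdsWithin] with s hs hs0
        have hs' : (s, x) ∈ Metric.ball ((0 : ℝ), x₀) δ :=
          Metric.ball_subset_ball (half_le_self hδ.le) hs
        exact (hd hs').unique (hne (hdouble hs) hs0)
      have hl : Filter.Tendsto (fun s : ℝ => fderiv ℝ (fun z => Γ z 1) (s, x) (1, 0)) (𝓝[≠] 0)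
          (𝓝 (fderiv ℝ (fun z => Γ z 1) (0, x) (1, 0))) :=
        (((hreg.continuousAt_fderiv (by simp)).clm_apply continuousAt_const).tendsto.comp
          htend).mono_left nhdsWithin_le_nhds
      have hr : Filter.Tendsto (fun s : ℝ => f (Γ (s, x) 1)) (𝓝[≠] 0) (𝓝 (f (Γ (0, x) 1))) :=
        ((hf.continuous.continuousAt.tendsto.comp
          (hreg.continuousAt.tendsto.comp htend))).mono_left nhdsWithin_le_nhds
      exact (hd hx).congr_deriv (tendsto_nhds_unique hl (hr.congr' (hev.mono fun s hs => hs.symm)))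
    · exact hne (hdouble hz) ht
  · rw [integralEquation_eq_zero_iff] at hsol
    simpa using hsol 1

/-- Smooth dependence of the solutions of an autonomous equation on time and on the initial
value. -/
theorem exists_smooth_flow [FiniteDimensional ℝ A] {f : A → A} {x₀ : A}
    (hf : ∀ᶠ x in 𝓝 x₀, ContDiffAt ℝ ∞ f x) :
    ∃ φ : ℝ × A → A, ∀ᶠ z in 𝓝 ((0 : ℝ), x₀), ContDiffAt ℝ ∞ φ z ∧
      HasDerivAt (fun t => φ (t, z.2)) (f (φ z)) z.1 ∧ φ (0, z.2) = z.2 := by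
  have := FiniteDimensional.complete ℝ A
  obtain ⟨r, hr, hball⟩ := Metric.eventually_nhds_iff_ball.1 hf
  -- The cutoff has its support inside the ball of radius `r` on which `f` is smooth, so `χ • f` is
  -- globally smooth.
  let χ : ContDiffBump x₀ := ⟨r / 4, r / 2, by positivity, by linarith⟩
  have hχ : ContDiff ℝ ∞ fun x => χ x • f x := by
    rw [contDiff_iff_contDiffAt]
    intro x
    by_cases hx : x ∈ Metric.ball x₀ r
    · exact χ.contDiffAt.smul (hball x hx)
    · have hx' : x ∉ tsupport χ := by
        rw [χ.tsupport_eq]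
        exact fun h => hx (Metric.closedBall_subset_ball (half_lt_self hr) h)
      have h0 : (fun x => χ x • f x) =ᶠ[𝓝 x] fun _ => 0 := by
        filter_upwards [notMem_tsupport_iff_eventuallyEq.1 hx'] with y hy
        simp [hy]
      exact contDiffAt_const.congr_of_eventuallyEq h0
  obtain ⟨φ, hφ⟩ := exists_smooth_flow_of_contDiff hχ x₀
  refine ⟨φ, ?_⟩
  have h00 := hφ.self_of_nhds
  have htend : Filter.Tendsto φ (𝓝 ((0 : ℝ), x₀)) (𝓝 x₀) := by
    have := h00.1.continuousAt
    rw [ContinuousAt, h00.2.2] at this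
    exact this
  -- For short times the flow stays where `χ = 1`, and there it is the flow of `f`.
  filter_upwards [hφ, htend.eventually χ.eventuallyEq_one] with z hz hz1
  refine ⟨hz.1, ?_, hz.2.2⟩
  have h := hz.2.1
  rw [hz1, Pi.one_apply, one_smul] at h
  exact h

end Flow

/-! ### The method of characteristics for the Hamilton–Jacobi equation. -/

section HamiltonJacobi

variable {B G : Type*} [NormedAddCommGroup B] [NormedSpace ℝ B] [NormedAddCommGroup G]
  [NormedSpace ℝ G]

/-- For the product norm a ball is a product of balls, so the segment in time from `(0, z.2)` to `z`
stays inside it. -/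
theorem eq_of_fderiv_time_eq_zero {k : ℝ × B → G} {b₀ : B} {δ : ℝ}
    (hk : ∀ z ∈ Metric.ball ((0 : ℝ), b₀) δ, DifferentiableAt ℝ k z ∧ fderiv ℝ k z (1, 0) = 0)
    {z : ℝ × B} (hz : z ∈ Metric.ball ((0 : ℝ), b₀) δ) : k z = k (0, z.2) := by
  obtain ⟨t, b⟩ := z
  rw [← ball_prod_same] at hz hk
  have hder : ∀ s ∈ Metric.ball (0 : ℝ) δ, HasDerivWithinAt (fun s => k (s, b)) 0
      (Metric.ball (0 : ℝ) δ) s := by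
    intro s hs
    have h := hk (s, b) ⟨hs, hz.2⟩
    have h1 : HasDerivAt (fun s : ℝ => (s, b)) ((1 : ℝ), (0 : B)) s :=
      (hasDerivAt_id s).prodMk (hasDerivAt_const s b)
    have h2 := HasFDerivAt.comp_hasDerivAt (l := k) s h.1.hasFDerivAt h1
    rw [h.2] at h2
    exact h2.hasDerivWithinAt
  have h0 : (0 : ℝ) ∈ Metric.ball (0 : ℝ) δ :=
    Metric.mem_ball_self (lt_of_le_of_lt dist_nonneg (Metric.mem_ball.1 hz.1))
  have h := (convex_ball (0 : ℝ) δ).norm_image_sub_le_of_norm_hasDerivWithin_le (C := 0) hder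
    (fun s _ => by simp) h0 hz.1
  rw [zero_mul, norm_le_zero_iff, sub_eq_zero] at h
  exact h

theorem fderiv_fderiv_apply_swap {k : B → G} {z : B} (hk : ContDiffAt ℝ ∞ k z) (a b : B) :
    fderiv ℝ (fun z => fderiv ℝ k z a) z b = fderiv ℝ (fun z => fderiv ℝ k z b) z a := by
  have hd : DifferentiableAt ℝ (fderiv ℝ k) z :=
    (hk.fderiv_right (m := ∞) (by simp)).differentiableAt (by simp)
  have key : ∀ c d : B, fderiv ℝ (fun z => fderiv ℝ k z c) z d = fderiv ℝ (fderiv ℝ k) z d c := by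
    intro c d
    rw [fderiv_clm_apply hd (differentiableAt_const c)]
    simp
  rw [key, key]
  exact (hk.isSymmSndFDerivAt (by
    rw [minSmoothness_of_isRCLikeNormedField]; exact ENat.LEInfty.out)) b a

theorem contDiffAt_fderiv_infty {k : B → G} {z : B} (hk : ContDiffAt ℝ ∞ k z) :
    ContDiffAt ℝ ∞ (fderiv ℝ k) z :=
  hk.fderiv_right (by simp)

variable {E : Type v} [NormedAddCommGroup E] [NormedSpace ℝ E]

/-- Along a family of characteristics of the Hamiltonian `H` issued from an initial submanifold of
a level set of `H`, the Hamiltonian is constant and the contact form `dz - p dx` vanishes as soon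
as it vanishes on the initial submanifold. -/
theorem characteristics_isotropic {H : E × (E →L[ℝ] ℝ) → ℝ} {V : E × (E →L[ℝ] ℝ) → E} {b₀ : B}
    {X : ℝ × B → E} {P : ℝ × B → E →L[ℝ] ℝ} {Z : ℝ × B → ℝ} {e : ℝ}
    (hsm : ∀ᶠ z in 𝓝 ((0 : ℝ), b₀), ContDiffAt ℝ ∞ X z ∧ ContDiffAt ℝ ∞ P z ∧
      ContDiffAt ℝ ∞ Z z ∧ ContDiffAt ℝ ∞ H (X z, P z) ∧ ContDiffAt ℝ ∞ V (X z, P z))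
    (hHV : ∀ᶠ z in 𝓝 ((0 : ℝ), b₀), ∀ q, fderiv ℝ H (X z, P z) (0, q) = q (V (X z, P z)))
    (hX : ∀ᶠ z in 𝓝 ((0 : ℝ), b₀), fderiv ℝ X z (1, 0) = V (X z, P z))
    (hP : ∀ᶠ z in 𝓝 ((0 : ℝ), b₀),
      fderiv ℝ P z (1, 0) = -(fderiv ℝ H (X z, P z)).comp (.inl ℝ E (E →L[ℝ] ℝ)))
    (hZ : ∀ᶠ z in 𝓝 ((0 : ℝ), b₀), fderiv ℝ Z z (1, 0) = P z (V (X z, P z)))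
    (hH0 : ∀ᶠ z in 𝓝 ((0 : ℝ), b₀), H (X (0, z.2), P (0, z.2)) = e)
    (hr0 : ∀ᶠ z in 𝓝 ((0 : ℝ), b₀), ∀ h, fderiv ℝ Z (0, z.2) (0, h) =
      P (0, z.2) (fderiv ℝ X (0, z.2) (0, h))) :
    ∀ᶠ z in 𝓝 ((0 : ℝ), b₀), H (X z, P z) = e ∧ ∀ h, fderiv ℝ Z z h = P z (fderiv ℝ X z h) := by
  obtain ⟨δ, hδ, hall⟩ := Metric.eventually_nhds_iff_ball.1
    (hsm.and (hHV.and (hX.and (hP.and (hZ.and (hH0.and hr0))))))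
  have hXP : ∀ z ∈ Metric.ball ((0 : ℝ), b₀) δ, ∀ h, fderiv ℝ (fun z => H (X z, P z)) z h =
      fderiv ℝ H (X z, P z) (fderiv ℝ X z h, 0) + (fderiv ℝ P z h) (V (X z, P z)) := by
    intro z hz h
    obtain ⟨⟨h1, h2, -, h4, -⟩, h5, -⟩ := hall z hz
    have hd := (h4.differentiableAt (by simp)).hasFDerivAt.comp z
      ((h1.differentiableAt (by simp)).hasFDerivAt.prodMk
        (h2.differentiableAt (by simp)).hasFDerivAt)
    have hd' : HasFDerivAt (fun z => H (X z, P z)) _ z := hd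
    rw [hd'.fderiv, ← h5 (fderiv ℝ P z h), ← map_add]
    simp
  have hE : ∀ z ∈ Metric.ball ((0 : ℝ), b₀) δ, H (X z, P z) = e := by
    intro z hz
    rw [eq_of_fderiv_time_eq_zero (k := fun z => H (X z, P z)) (fun z hz => ?_) hz]
    · exact (hall z hz).2.2.2.2.2.1
    · obtain ⟨⟨h1, h2, -, h4, -⟩, h5, h6, h7, -⟩ := hall z hz
      refine ⟨?_, ?_⟩
      · exact (h4.differentiableAt (by simp)).comp z
          ((h1.differentiableAt (by simp)).prodMk (h2.differentiableAt (by simp)))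
      · rw [hXP z hz, h6, h7]
        simp
  -- With subscripts for derivatives,
  -- $\partial_t(Z_h-PX_h)=\partial_h(PV)-P_tX_h-P\,\partial_hV=P_hV+H_xX_h$. This is the derivative
  -- of $H(X,P)$ in the direction $h$, which vanishes by `hE`.
  have hr : ∀ h, ∀ z ∈ Metric.ball ((0 : ℝ), b₀) δ,
      fderiv ℝ Z z (0, h) - P z (fderiv ℝ X z (0, h)) = 0 := by
    intro h z hz
    rw [eq_of_fderiv_time_eq_zero
      (k := fun z => fderiv ℝ Z z (0, h) - P z (fderiv ℝ X z (0, h))) (fun z hz => ?_) hz]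
    · exact sub_eq_zero.2 ((hall z hz).2.2.2.2.2.2 h)
    · have hnhds := Metric.isOpen_ball.mem_nhds hz
      obtain ⟨⟨h1, h2, h3, h4, h5⟩, -, h6, h7, -⟩ := hall z hz
      have dP := h2.differentiableAt (by simp)
      have dX := ((contDiffAt_fderiv_infty h1).differentiableAt (by simp)).clm_apply
        (differentiableAt_const ((0 : ℝ), h))
      have dZ := ((contDiffAt_fderiv_infty h3).differentiableAt (by simp)).clm_apply
        (differentiableAt_const ((0 : ℝ), h))
      have dV : DifferentiableAt ℝ (fun z => V (X z, P z)) z :=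
        (h5.differentiableAt (by simp)).comp z
          ((h1.differentiableAt (by simp)).prodMk (h2.differentiableAt (by simp)))
      refine ⟨dZ.sub (dP.clm_apply dX), ?_⟩
      have e1 : (fun z => fderiv ℝ Z z (1, 0)) =ᶠ[𝓝 z] fun z => P z (V (X z, P z)) := by
        filter_upwards [hnhds] with y hy using (hall y hy).2.2.2.2.1
      have e2 : (fun z => fderiv ℝ X z (1, 0)) =ᶠ[𝓝 z] fun z => V (X z, P z) := by
        filter_upwards [hnhds] with y hy using (hall y hy).2.2.1
      have e3 : (fun z => H (X z, P z)) =ᶠ[𝓝 z] fun _ => e := by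
        filter_upwards [hnhds] with y hy using hE y hy
      have e4 := hXP z hz (0, h)
      rw [e3.fderiv_eq, fderiv_fun_const] at e4
      rw [fderiv_fun_sub dZ (dP.clm_apply dX), fderiv_clm_apply dP dX, sub_apply,
        fderiv_fderiv_apply_swap h3, e1.fderiv_eq, fderiv_clm_apply dP dV]
      simp only [_root_.add_apply, ContinuousLinearMap.comp_apply,
        ContinuousLinearMap.flip_apply]
      rw [fderiv_fderiv_apply_swap h1, e2.fderiv_eq, h7]
      simp at e4 ⊢
      linarith
  filter_upwards [Metric.ball_mem_nhds _ hδ] with z hz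
  refine ⟨hE z hz, fun h => ?_⟩
  -- In the time direction the contact form vanishes by the equations `hX` and `hZ`; in the
  -- remaining directions this is `hr`.
  have hsplit : h = h.1 • ((1 : ℝ), (0 : B)) + ((0 : ℝ), h.2) := by ext <;> simp
  obtain ⟨-, -, h6, -, h8, -⟩ := hall z hz
  rw [hsplit, map_add, map_add, map_smul, map_smul, map_add, map_smul, h6, h8,
    sub_eq_zero.1 (hr h.2 z hz)]

end HamiltonJacobi

section HamiltonJacobi
variable {E : Type v} [NormedAddCommGroup E] [NormedSpace ℝ E]

/-- The characteristic vector field of the Hamiltonian `H`, with `V = ∂H/∂p`. -/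
noncomputable def characteristicField (H : E × (E →L[ℝ] ℝ) → ℝ) (V : E × (E →L[ℝ] ℝ) → E)
    (y : E × (E →L[ℝ] ℝ) × ℝ) : E × (E →L[ℝ] ℝ) × ℝ :=
  (V (y.1, y.2.1), -(fderiv ℝ H (y.1, y.2.1)).comp (.inl ℝ E (E →L[ℝ] ℝ)),
    y.2.1 (V (y.1, y.2.1)))

theorem contDiffAt_characteristicField {H : E × (E →L[ℝ] ℝ) → ℝ} {V : E × (E →L[ℝ] ℝ) → E}
    {y : E × (E →L[ℝ] ℝ) × ℝ} (hH : ContDiffAt ℝ ∞ H (y.1, y.2.1))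
    (hV : ContDiffAt ℝ ∞ V (y.1, y.2.1)) : ContDiffAt ℝ ∞ (characteristicField H V) y := by
  have hxp : ContDiffAt ℝ ∞ (fun y : E × (E →L[ℝ] ℝ) × ℝ => (y.1, y.2.1)) y := by fun_prop
  have hV' : ContDiffAt ℝ ∞ (fun y : E × (E →L[ℝ] ℝ) × ℝ => V (y.1, y.2.1)) y :=
    ContDiffAt.comp (g := V) y hV hxp
  have hH' : ContDiffAt ℝ ∞ (fun y : E × (E →L[ℝ] ℝ) × ℝ => fderiv ℝ H (y.1, y.2.1)) y :=
    ContDiffAt.comp (g := fderiv ℝ H) y (contDiffAt_fderiv_infty hH) hxp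
  have hp : ContDiffAt ℝ ∞ (fun y : E × (E →L[ℝ] ℝ) × ℝ => y.2.1) y := by fun_prop
  exact hV'.prodMk (((hH'.clm_comp contDiffAt_const).neg).prodMk (hp.clm_apply hV'))

/-- Local solvability of the Hamilton-Jacobi equation `H(x, dS) = const` near a point of the phase
space at which `V = ∂H/∂p` does not vanish. -/
theorem exists_local_solution_hamiltonJacobi [FiniteDimensional ℝ E]
    {H : E × (E →L[ℝ] ℝ) → ℝ} {V : E × (E →L[ℝ] ℝ) → E} {x₀ : E} {p₀ : E →L[ℝ] ℝ}
    (hH : ∀ᶠ z in 𝓝 (x₀, p₀), ContDiffAt ℝ ∞ H z) (hV : ∀ᶠ z in 𝓝 (x₀, p₀), ContDiffAt ℝ ∞ V z)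
    (hHV : ∀ᶠ z in 𝓝 (x₀, p₀), ∀ q, fderiv ℝ H z (0, q) = q (V z)) (hne : V (x₀, p₀) ≠ 0) :
    ∃ S : E → ℝ, ∀ᶠ x in 𝓝 x₀, ContDiffAt ℝ ∞ S x ∧ H (x, fderiv ℝ S x) = H (x₀, p₀) := by
  have := FiniteDimensional.complete ℝ E
  set w := V (x₀, p₀) with hw
  -- The initial hyperplane is `x₀ + ker ν`; the normalization makes the characteristic through `x₀`
  -- transverse to it.
  obtain ⟨ν, hν⟩ : ∃ ν : E →L[ℝ] ℝ, ν w = 1 := SeparatingDual.exists_eq_one hne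
  -- the projection onto the initial hyperplane
  let σ : E →L[ℝ] E := .id ℝ E - ν.smulRight w
  have hσ : ∀ y, σ y = y - ν y • w := fun y => rfl
  have hνσ : ∀ y, ν (σ y) = 0 := fun y => by rw [hσ, map_sub, map_smul, hν]; simp
  -- the initial momenta
  let ι : E × ℝ → E × (E →L[ℝ] ℝ) := fun v => (x₀ + σ v.1, p₀ + v.2 • ν)
  have hι : ContDiff ℝ ∞ ι := by fun_prop
  have hι0 : ι (0, 0) = (x₀, p₀) := by simp [ι]
  have hιt : Filter.Tendsto ι (𝓝 (0, 0)) (𝓝 (x₀, p₀)) := by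
    have := hι.continuous.tendsto (0, 0)
    rwa [hι0] at this
  have hK : ∀ᶠ v in 𝓝 ((0 : E), (0 : ℝ)), ContDiffAt ℝ ∞ (H ∘ ι) v :=
    (hιt.eventually hH).mono fun v hv => hv.comp v hι.contDiffAt
  -- The derivative of `H (p₀ + l • ν)` in `l` is `ν w = 1`, so the energy condition determines the
  -- normal component `l` of the initial momentum.
  have hKinv : (fderiv ℝ (H ∘ ι) (0, 0) ∘L .inr ℝ E ℝ).IsInvertible := by
    have h1 : HasFDerivAt H (fderiv ℝ H (x₀, p₀)) (ι (0, 0)) := by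
      rw [hι0]
      exact (hH.self_of_nhds.differentiableAt (by simp)).hasFDerivAt
    have h2 : HasFDerivAt ι ((σ.comp (.fst ℝ E ℝ)).prod
        ((ContinuousLinearMap.snd ℝ E ℝ).smulRight ν))
        (0, 0) :=
      ((σ.comp (.fst ℝ E ℝ)).hasFDerivAt.const_add x₀).prodMk
        (((ContinuousLinearMap.snd ℝ E ℝ).smulRight ν).hasFDerivAt.const_add p₀)
    have h3 : fderiv ℝ (H ∘ ι) (0, 0) ∘L .inr ℝ E ℝ = .id ℝ ℝ := by
      rw [(h1.comp _ h2).fderiv]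
      ext
      simp [hHV.self_of_nhds, ← hw, hν]
    rw [h3]
    exact ⟨.refl ℝ ℝ, rfl⟩
  obtain ⟨l, hl0, hlsm, hlH, -⟩ := exists_smooth_implicit hK hKinv
  dsimp only at hl0 hlsm hlH
  -- the flow-out of the initial submanifold
  obtain ⟨φ, hφ⟩ := exists_smooth_flow (f := characteristicField H V)
    (x₀ := (x₀, p₀, (0 : ℝ))) (by
      have ht : Filter.Tendsto (fun y : E × (E →L[ℝ] ℝ) × ℝ => (y.1, y.2.1)) (𝓝 (x₀, p₀, 0))
          (𝓝 (x₀, p₀)) := by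
        have h : Continuous fun y : E × (E →L[ℝ] ℝ) × ℝ => (y.1, y.2.1) := by fun_prop
        exact h.tendsto (x₀, p₀, 0)
      filter_upwards [ht.eventually hH, ht.eventually hV] with y h1 h2
        using contDiffAt_characteristicField h1 h2)
  -- The data on the hyperplane are those of the linear function `p₀`. The parameter `y` ranges over
  -- all of `E`, with its component along `w` removed by `σ`, so that no basis of the hyperplane is
  -- needed.
  let Ξ : E → E × (E →L[ℝ] ℝ) × ℝ := fun y => (x₀ + σ y, p₀ + l y • ν, p₀ (σ y))
  have hΞ0 : Ξ 0 = (x₀, p₀, 0) := by simp [Ξ, hl0]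
  have hΞ : ∀ᶠ y in 𝓝 (0 : E), ContDiffAt ℝ ∞ Ξ y := by
    filter_upwards [hlsm] with y hy
    have h1 : ContDiffAt ℝ ∞ (fun y => x₀ + σ y) y := by fun_prop
    have h2 : ContDiffAt ℝ ∞ (fun y => p₀ (σ y)) y := by fun_prop
    exact h1.prodMk ((contDiffAt_const.add (hy.smul contDiffAt_const)).prodMk h2)
  have hΞt : Filter.Tendsto (fun z : ℝ × E => (z.1, Ξ z.2)) (𝓝 (0, 0)) (𝓝 (0, (x₀, p₀, 0))) := by
    have h : ContinuousAt (fun z : ℝ × E => (z.1, Ξ z.2)) (0, 0) :=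
      continuousAt_fst.prodMk
        (ContinuousAt.comp (g := Ξ) hΞ.self_of_nhds.continuousAt continuousAt_snd)
    rw [ContinuousAt, hΞ0] at h
    exact h
  have hsnd : Filter.Tendsto (Prod.snd : ℝ × E → E) (𝓝 (0, 0)) (𝓝 0) :=
    continuous_snd.tendsto (0, 0)
  let Θ : ℝ × E → E × (E →L[ℝ] ℝ) × ℝ := fun z => φ (z.1, Ξ z.2)
  have hΘ : ∀ᶠ z in 𝓝 ((0 : ℝ), (0 : E)), ContDiffAt ℝ ∞ Θ z := by
    filter_upwards [hΞt.eventually hφ, hsnd.eventually hΞ] with z h1 h2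
    exact ContDiffAt.comp (g := φ) z h1.1
      (contDiffAt_fst.prodMk (ContDiffAt.comp (g := Ξ) z h2 contDiffAt_snd))
  have hΘ' : ∀ᶠ z in 𝓝 ((0 : ℝ), (0 : E)),
      fderiv ℝ Θ z (1, 0) = characteristicField H V (Θ z) := by
    filter_upwards [hΘ, hΞt.eventually hφ] with z h1 h2
    have h3 : HasDerivAt (fun s : ℝ => (s, z.2)) ((1 : ℝ), (0 : E)) z.1 :=
      (hasDerivAt_id _).prodMk (hasDerivAt_const _ _)
    exact (HasFDerivAt.comp_hasDerivAt (l := Θ) z.1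
      (h1.differentiableAt (by simp)).hasFDerivAt h3).unique h2.2.1
  have hΘ0 : ∀ᶠ z in 𝓝 ((0 : ℝ), (0 : E)), Θ (0, z.2) = Ξ z.2 := by
    filter_upwards [hΞt.eventually hφ] with z h1 using h1.2.2
  let X : ℝ × E → E := fun z => (Θ z).1
  let P : ℝ × E → E →L[ℝ] ℝ := fun z => (Θ z).2.1
  let Z : ℝ × E → ℝ := fun z => (Θ z).2.2
  have hXPt : Filter.Tendsto (fun z => (X z, P z)) (𝓝 (0, 0)) (𝓝 (x₀, p₀)) := by
    have h := hΘ.self_of_nhds.continuousAt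
    have h' : ContinuousAt (fun z => (X z, P z)) (0, 0) :=
      h.fst.prodMk h.snd.fst
    have h0 : Θ (0, 0) = (x₀, p₀, 0) := hΘ0.self_of_nhds.trans hΞ0
    rw [ContinuousAt] at h'
    simpa [X, P, h0] using h'
  have hder : ∀ᶠ z in 𝓝 ((0 : ℝ), (0 : E)), ∀ h, fderiv ℝ X z h = (fderiv ℝ Θ z h).1 ∧
      fderiv ℝ P z h = (fderiv ℝ Θ z h).2.1 ∧ fderiv ℝ Z z h = (fderiv ℝ Θ z h).2.2 := by
    filter_upwards [hΘ] with z hz h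
    have hd := (hz.differentiableAt (by simp)).hasFDerivAt
    exact ⟨by rw [hd.fst.fderiv]; rfl, by rw [hd.snd.fst.fderiv]; rfl,
      by rw [hd.snd.snd.fderiv]; rfl⟩
  have hinit : ∀ᶠ z in 𝓝 ((0 : ℝ), (0 : E)), ∀ h, fderiv ℝ X (0, z.2) (0, h) = σ h ∧
      fderiv ℝ Z (0, z.2) (0, h) = p₀ (σ h) ∧ P (0, z.2) = p₀ + l z.2 • ν := by
    have hinr : Filter.Tendsto (fun y : E => ((0 : ℝ), y)) (𝓝 0) (𝓝 (0, 0)) :=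
      (Continuous.prodMk_right (0 : ℝ)).tendsto 0
    filter_upwards [hsnd.eventually (hinr.eventually hΘ),
      hsnd.eventually (hinr.eventually hΘ0).eventually_nhds] with z h1 h2 h
    have hX : HasFDerivAt (fun y => X (0, y)) (fderiv ℝ X (0, z.2) ∘L .inr ℝ ℝ E) z.2 :=
      HasFDerivAt.comp (g := X) z.2 (h1.fst.differentiableAt (by simp)).hasFDerivAt
        (hasFDerivAt_prodMk_right 0 z.2)
    have hZ : HasFDerivAt (fun y => Z (0, y)) (fderiv ℝ Z (0, z.2) ∘L .inr ℝ ℝ E) z.2 :=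
      HasFDerivAt.comp (g := Z) z.2 (h1.snd.snd.differentiableAt (by simp)).hasFDerivAt
        (hasFDerivAt_prodMk_right 0 z.2)
    have hX' : (fun y => X (0, y)) =ᶠ[𝓝 z.2] fun y => x₀ + σ y :=
      h2.mono fun y hy => congrArg Prod.fst hy
    have hZ' : (fun y => Z (0, y)) =ᶠ[𝓝 z.2] fun y => p₀ (σ y) :=
      h2.mono fun y hy => congrArg (fun u => u.2.2) hy
    have hP' : P (0, z.2) = p₀ + l z.2 • ν := congrArg (fun u => u.2.1) h2.self_of_nhds
    have eX := DFunLike.congr_fun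
      (hX.unique ((σ.hasFDerivAt.const_add x₀).congr_of_eventuallyEq hX')) h
    have eZ := DFunLike.congr_fun
      (hZ.unique ((p₀.comp σ).hasFDerivAt.congr_of_eventuallyEq hZ')) h
    simp only [ContinuousLinearMap.comp_apply, ContinuousLinearMap.inr_apply] at eX eZ
    exact ⟨eX, eZ, hP'⟩
  have hmain := characteristics_isotropic (H := H) (V := V) (b₀ := (0 : E)) (X := X) (P := P)
    (Z := Z) (e := H (x₀, p₀))
    (by
      filter_upwards [hΘ, hXPt.eventually hH, hXPt.eventually hV] with z h1 h2 h3
      exact ⟨h1.fst, h1.snd.fst, h1.snd.snd, h2, h3⟩)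
    (hXPt.eventually hHV)
    (by filter_upwards [hder, hΘ'] with z h1 h2; rw [(h1 _).1, h2]; rfl)
    (by filter_upwards [hder, hΘ'] with z h1 h2; rw [(h1 _).2.1, h2]; rfl)
    (by filter_upwards [hder, hΘ'] with z h1 h2; rw [(h1 _).2.2, h2]; rfl)
    (by
      filter_upwards [hΘ0, hsnd.eventually hlH] with z h1 h2
      simp only [X, P, h1, Ξ]
      rw [← hι0]
      exact h2)
    (by
      filter_upwards [hinit] with z hz h
      obtain ⟨eX, eZ, hP'⟩ := hz h
      -- The correction `l • ν` of the momentum is invisible along the hyperplane, since `ν ∘ σ =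
      -- 0`.
      rw [eX, eZ, hP', _root_.add_apply, _root_.smul_apply, hνσ, smul_zero, add_zero])
  -- the projection of the flow-out to the base is a local diffeomorphism
  let c : E →L[ℝ] ℝ × E := ν.prod (.id ℝ E)
  have hct : Filter.Tendsto c (𝓝 0) (𝓝 (0, 0)) := by
    have h := c.continuous.tendsto 0
    rwa [map_zero] at h
  have hΦsm : ∀ᶠ y in 𝓝 (0 : E), ContDiffAt ℝ ∞ (X ∘ c) y := by
    filter_upwards [hct.eventually hΘ] with y hy
    exact ContDiffAt.comp (g := X) y hy.fst c.contDiff.contDiffAt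
  have hΦder : ∀ᶠ y in 𝓝 (0 : E), fderiv ℝ (X ∘ c) y = (fderiv ℝ X (c y)).comp c := by
    filter_upwards [hct.eventually hΘ] with y hy
    exact (HasFDerivAt.comp y (hy.fst.differentiableAt (by simp)).hasFDerivAt
      c.hasFDerivAt).fderiv
  have hX0 : ∀ h, fderiv ℝ X (0, 0) (0, h) = σ h := fun h => (hinit.self_of_nhds h).1
  -- The differential is `h ↦ ν h • w + σ h = h`: the map `c` uses as time exactly the component
  -- along `w` that `σ` discards.
  have hΦ0 : fderiv ℝ (X ∘ c) 0 = .id ℝ E := by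
    rw [hΦder.self_of_nhds, map_zero]
    ext h
    have e1 : c h = ν h • ((1 : ℝ), (0 : E)) + ((0 : ℝ), h) := by ext <;> simp [c]
    have e2 := (hder.self_of_nhds (1, 0)).1
    have e3 : Θ (0, 0) = (x₀, p₀, 0) := hΘ0.self_of_nhds.trans hΞ0
    rw [hΘ'.self_of_nhds, e3] at e2
    have e4 : fderiv ℝ X (0, 0) (1, 0) = w := e2
    rw [ContinuousLinearMap.comp_apply, e1, map_add, map_smul]
    erw [e4, hX0]
    simp [hσ]
  have hΦbase : (X ∘ c) 0 = x₀ := by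
    have e3 : Θ (0, 0) = (x₀, p₀, 0) := hΘ0.self_of_nhds.trans hΞ0
    change (Θ (c 0)).1 = x₀
    rw [map_zero]
    exact congrArg Prod.fst e3
  -- A local inverse of `X ∘ c`, obtained from the implicit equation `(X ∘ c) y - x = 0` so that it
  -- is smooth on a whole neighbourhood.
  obtain ⟨Γ, hΓ0, hΓsm, hΓ, -⟩ := exists_smooth_implicit
    (f := fun v : E × E => (X ∘ c) v.2 - v.1) (u := (x₀, (0 : E)))
    (by
      have h : Filter.Tendsto (Prod.snd : E × E → E) (𝓝 (x₀, 0)) (𝓝 0) :=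
        continuous_snd.tendsto (x₀, 0)
      filter_upwards [h.eventually hΦsm] with v hv
      exact (ContDiffAt.comp (g := X ∘ c) v hv contDiffAt_snd).sub contDiffAt_fst)
    (by
      have h1 : HasFDerivAt (fun v : E × E => (X ∘ c) v.2 - v.1)
          ((fderiv ℝ (X ∘ c) 0).comp (.snd ℝ E E) - .fst ℝ E E) (x₀, 0) :=
        (HasFDerivAt.comp (g := X ∘ c) (f := Prod.snd) (x₀, (0 : E))
          (hΦsm.self_of_nhds.differentiableAt (by simp)).hasFDerivAt hasFDerivAt_snd).sub
          hasFDerivAt_fst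
      have h2 : fderiv ℝ (fun v : E × E => (X ∘ c) v.2 - v.1) (x₀, 0) ∘L .inr ℝ E E =
          .id ℝ E := by
        rw [h1.fderiv, hΦ0]
        ext
        simp
      rw [h2]
      exact ⟨.refl ℝ E, rfl⟩)
  dsimp only at hΓ0 hΓsm hΓ
  rw [hΦbase, sub_self] at hΓ
  have hΓt : Filter.Tendsto Γ (𝓝 x₀) (𝓝 0) := by
    have h := hΓsm.self_of_nhds.continuousAt
    rwa [ContinuousAt, hΓ0] at h
  refine ⟨fun x => Z (c (Γ x)), ?_⟩
  filter_upwards [hΓsm, hΓ.eventually_nhds, hΓt.eventually (hct.eventually (hΘ.and hmain)),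
    hΓt.eventually hΦsm, hΓt.eventually hΦder] with x h1 h2 ⟨h3, h4, h5⟩ h6 h7
  have hcΓ : ContDiffAt ℝ ∞ (fun x => c (Γ x)) x := c.contDiff.contDiffAt.comp x h1
  refine ⟨ContDiffAt.comp (g := Z) x h3.snd.snd hcΓ, ?_⟩
  have e1 : HasFDerivAt (fun x => X (c (Γ x))) ((fderiv ℝ X (c (Γ x))).comp
      (c.comp (fderiv ℝ Γ x))) x :=
    HasFDerivAt.comp (g := X) x (h3.fst.differentiableAt (by simp)).hasFDerivAt
      (c.hasFDerivAt.comp x (h1.differentiableAt (by simp)).hasFDerivAt)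
  have e2 : HasFDerivAt (fun x => Z (c (Γ x))) ((fderiv ℝ Z (c (Γ x))).comp
      (c.comp (fderiv ℝ Γ x))) x :=
    HasFDerivAt.comp (g := Z) x (h3.snd.snd.differentiableAt (by simp)).hasFDerivAt
      (c.hasFDerivAt.comp x (h1.differentiableAt (by simp)).hasFDerivAt)
  have e3 : (fun x => X (c (Γ x))) =ᶠ[𝓝 x] id := h2.mono fun y hy => sub_eq_zero.1 hy
  have e4 := e1.unique ((hasFDerivAt_id x).congr_of_eventuallyEq e3)
  -- Since `dZ = P dX` on the flow-out and `X ∘ c ∘ Γ` is the identity, the differential of the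
  -- action is the momentum.
  have e5 : fderiv ℝ (fun x => Z (c (Γ x))) x = P (c (Γ x)) := by
    rw [e2.fderiv]
    ext h
    rw [ContinuousLinearMap.comp_apply, h5]
    exact congrArg (P (c (Γ x))) (DFunLike.congr_fun e4 h)
  rw [e5, ← h4, show X (c (Γ x)) = x from e3.self_of_nhds]

end HamiltonJacobi

/-! ### Charts, pull-backs and the exterior derivative. -/

section Pullback

variable {F : Type*} [NormedAddCommGroup F] [NormedSpace ℝ F]
  {H : Type*} [TopologicalSpace H] {I : ModelWithCorners ℝ F H} [I.Boundaryless]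
  {N : Type*} [TopologicalSpace N] [ChartedSpace H N] [IsManifold I ∞ N]

theorem contMDiffAt_extChartAt_symm {x : N} {z : F} (hz : z ∈ (extChartAt I x).target) :
    ContMDiffAt 𝓘(ℝ, F) I ∞ (extChartAt I x).symm z :=
  (contMDiffOn_extChartAt_symm x).contMDiffAt ((isOpen_extChartAt_target x).mem_nhds hz)

theorem mdifferentiableAt_extChartAt_symm {x : N} {z : F} (hz : z ∈ (extChartAt I x).target) :
    MDifferentiableAt 𝓘(ℝ, F) I (extChartAt I x).symm z :=
  (contMDiffAt_extChartAt_symm hz).mdifferentiableAt (by simp)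

theorem mfderiv_extChartAt_symm_apply_mfderiv {x y : N} (hy : y ∈ (extChartAt I x).source)
    (ξ : TangentSpace I y) :
    mfderiv 𝓘(ℝ, F) I (extChartAt I x).symm (extChartAt I x y)
      (mfderiv I 𝓘(ℝ, F) (extChartAt I x) y ξ) = ξ := by
  have : IsManifold I 1 N := .of_le (n := ∞) ENat.LEInfty.out
  have h := mfderivWithin_extChartAt_symm_comp_mfderiv_extChartAt' hy
  rw [I.range_eq_univ, mfderivWithin_univ] at h
  exact DFunLike.congr_fun h ξ

theorem mfderiv_extChartAt_apply_mfderiv_symm {x y : N} (hy : y ∈ (extChartAt I x).source)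
    (a : F) :
    mfderiv I 𝓘(ℝ, F) (extChartAt I x) y
      (mfderiv 𝓘(ℝ, F) I (extChartAt I x).symm (extChartAt I x y) a) = a := by
  have : IsManifold I 1 N := .of_le (n := ∞) ENat.LEInfty.out
  have h := mfderiv_extChartAt_comp_mfderivWithin_extChartAt_symm' hy
  rw [I.range_eq_univ, mfderivWithin_univ] at h
  exact DFunLike.congr_fun h a

theorem exists_mfderiv_extChartAt_symm_eq {x : N} {z : F} (hz : z ∈ (extChartAt I x).target)
    (ξ : TangentSpace I ((extChartAt I x).symm z)) :
    ∃ a : F, mfderiv 𝓘(ℝ, F) I (extChartAt I x).symm z a = ξ := by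
  have h := mfderiv_extChartAt_symm_apply_mfderiv ((extChartAt I x).map_target hz) ξ
  rw [(extChartAt I x).right_inv hz] at h
  exact ⟨_, h⟩

theorem eq_zero_of_mfderiv_extChartAt_symm_eq_zero {x : N} {z : F}
    (hz : z ∈ (extChartAt I x).target) {a : F}
    (ha : mfderiv 𝓘(ℝ, F) I (extChartAt I x).symm z a = 0) : a = 0 := by
  have h := mfderiv_extChartAt_apply_mfderiv_symm ((extChartAt I x).map_target hz) a
  rw [(extChartAt I x).right_inv hz] at h
  rw [← h]
  exact (congrArg _ ha).trans (map_zero _)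

variable {V : Type*} [NormedAddCommGroup V] [NormedSpace ℝ V]

variable (I) in
/-- The pull-back of a 1-form by a map defined on a normed space. -/
noncomputable def OneForm.pullback (β : OneForm I (N := N)) (f : V → N) (y : V) : V →L[ℝ] ℝ :=
  (β (f y)).comp (mfderiv 𝓘(ℝ, V) I f y)

/-- The exterior derivative commutes with pull-backs. -/
theorem OneForm.extDeriv_mfderiv {β : OneForm I (N := N)} {f : V → N} {y : V}
    (hβ : DifferentiableAt ℝ (β.inChart I (f y)) (extChartAt I (f y) (f y)))
    (hf : ContMDiffAt 𝓘(ℝ, V) I ∞ f y) (a b : V) :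
    β.extDeriv I (f y) (mfderiv 𝓘(ℝ, V) I f y a) (mfderiv 𝓘(ℝ, V) I f y b) =
      fderiv ℝ (β.pullback I f) y a b - fderiv ℝ (β.pullback I f) y b a := by
  set φ := extChartAt I (f y) with hφ
  have hτ : ContDiffAt ℝ ∞ (φ ∘ f) y :=
    ((contMDiffAt_extChartAt (n := ∞)).comp y hf).contDiffAt
  have hder : ∀ a, mfderiv I 𝓘(ℝ, F) φ (f y) (mfderiv 𝓘(ℝ, V) I f y a) =
      fderiv ℝ (φ ∘ f) y a := by
    intro a
    rw [← mfderiv_eq_fderiv, mfderiv_comp y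
      ((contMDiffAt_extChartAt (n := ∞)).mdifferentiableAt (by simp))
      (hf.mdifferentiableAt (by simp))]
    rfl
  have : IsManifold I 1 N := .of_le (n := ∞) ENat.LEInfty.out
  have hf1 : ∀ᶠ z in 𝓝 y, ContMDiffAt 𝓘(ℝ, V) I 1 f z :=
    (contMDiffAt_iff_contMDiffAt_nhds (by simp)).1 (hf.of_le ENat.LEInfty.out)
  have hsrc : ∀ᶠ z in 𝓝 y, f z ∈ φ.source :=
    hf.continuousAt.eventually (extChartAt_source_mem_nhds (f y))
  have hpull : β.pullback I f =ᶠ[𝓝 y] fun z =>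
      (β.inChart I (f y) ((φ ∘ f) z)).comp (fderiv ℝ (φ ∘ f) z) := by
    filter_upwards [hf1.eventually_nhds, hsrc.eventually_nhds] with z h1 h2
    have h3 : MDifferentiableAt 𝓘(ℝ, V) 𝓘(ℝ, F) (φ ∘ f) z := by
      have := contMDiffAt_extChartAt' (I := I) (n := 1) (x := f y) (x' := f z)
        (by simpa [hφ] using h2.self_of_nhds)
      exact (this.comp z h1.self_of_nhds).mdifferentiableAt (by simp)
    have h4 : (φ ∘ f) z ∈ φ.target := φ.map_source h2.self_of_nhds
    have h5 : f =ᶠ[𝓝 z] φ.symm ∘ (φ ∘ f) := h2.mono fun w hw => (φ.left_inv hw).symm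
    have h6 : mfderiv 𝓘(ℝ, V) I f z =
        (mfderiv 𝓘(ℝ, F) I φ.symm ((φ ∘ f) z)).comp (mfderiv 𝓘(ℝ, V) 𝓘(ℝ, F) (φ ∘ f) z) := by
      rw [h5.mfderiv_eq]
      exact mfderiv_comp z (mdifferentiableAt_extChartAt_symm h4) h3
    have h7 : φ.symm ((φ ∘ f) z) = f z := φ.left_inv h2.self_of_nhds
    rw [mfderiv_eq_fderiv] at h6
    ext k
    change β (f z) (mfderiv 𝓘(ℝ, V) I f z k) = β (φ.symm ((φ ∘ f) z))
      (mfderiv 𝓘(ℝ, F) I φ.symm ((φ ∘ f) z) (fderiv ℝ (φ ∘ f) z k))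
    -- The two base points are equal only propositionally; quantifying over `q` permits substitution
    -- of one for the other.
    have h8 : ∀ (q : N) (hq : q = f z) (A : V →L[ℝ] TangentSpace I q),
        (mfderiv 𝓘(ℝ, V) I f z : V → F) = (A : V → F) →
        β (f z) (mfderiv 𝓘(ℝ, V) I f z k) = β q (A k) := by
      rintro _ rfl A hA
      exact congrArg (β (f z)) (congrFun hA k)
    exact h8 _ h7 ((mfderiv 𝓘(ℝ, F) I φ.symm ((φ ∘ f) z)).comp (fderiv ℝ (φ ∘ f) z))
      (congrArg (fun T : V →L[ℝ] F => (T : V → F)) h6)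
  have hd1 : HasFDerivAt (fun z => β.inChart I (f y) ((φ ∘ f) z)) _ y :=
    HasFDerivAt.comp (g := β.inChart I (f y)) (f := φ ∘ f) y hβ.hasFDerivAt
      (hτ.differentiableAt (by simp)).hasFDerivAt
  have hd2 := (contDiffAt_fderiv_infty hτ).differentiableAt (by simp)
  -- The last term contains the second derivative of `φ ∘ f`; it is symmetric in `a` and `b` and
  -- drops out on antisymmetrization.
  have key : ∀ a b, fderiv ℝ (β.pullback I f) y a b =
      fderiv ℝ (β.inChart I (f y)) (φ (f y)) (fderiv ℝ (φ ∘ f) y a) (fderiv ℝ (φ ∘ f) y b) +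
      β.inChart I (f y) ((φ ∘ f) y) (fderiv ℝ (fderiv ℝ (φ ∘ f)) y a b) := by
    intro a b
    rw [hpull.fderiv_eq, (hd1.clm_comp hd2.hasFDerivAt).fderiv]
    simp [add_comm]
  have hsymm := (hτ.isSymmSndFDerivAt
    (by rw [minSmoothness_of_isRCLikeNormedField]; exact ENat.LEInfty.out)) a b
  have e := fun a b => congrArg₂
    (fun s t => fderiv ℝ (β.inChart I (f y)) (φ (f y)) s t) (hder a) (hder b)
  refine (congrArg₂ (· - ·) (e a b) (e b a)).trans ?_
  rw [key, key, hsymm]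
  ring

end Pullback

/-! ### Vector fields with a prescribed coordinate expression. -/

section CoordField

variable {F : Type*} [NormedAddCommGroup F] [NormedSpace ℝ F]
  {H : Type*} [TopologicalSpace H] (I : ModelWithCorners ℝ F H) [I.Boundaryless]
  {N : Type*} [TopologicalSpace N] [ChartedSpace H N] [IsManifold I ∞ N]

/-- The vector field whose expression in the preferred chart at `c` is `W`. -/
noncomputable def coordField (c : N) (W : F → F) (q : N) : TangentSpace I q :=
  (mfderiv 𝓘(ℝ, F) I (extChartAt I c).symm (extChartAt I c q) (W (extChartAt I c q)) : F)

variable {I}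

theorem mfderiv_extChartAt_coordField {c q : N} (hq : q ∈ (extChartAt I c).source) (W : F → F) :
    mfderiv I 𝓘(ℝ, F) (extChartAt I c) q (coordField I c W q) = W (extChartAt I c q) :=
  mfderiv_extChartAt_apply_mfderiv_symm hq _

/-- In the trivialization of the tangent bundle at `c`, the fibre component of the field is `W`
composed with the chart. -/
theorem contMDiffAt_coordField {c q : N} (hq : q ∈ (extChartAt I c).source) {W : F → F}
    (hW : ContDiffAt ℝ ∞ W (extChartAt I c q)) :
    ContMDiffAt I I.tangent ∞ (fun q : N => (⟨q, coordField I c W q⟩ : TangentBundle I N)) q := by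
  have : IsManifold I 1 N := .of_le (n := ∞) ENat.LEInfty.out
  have : IsManifold I (∞ + 1) N := ‹IsManifold I ∞ N›
  have : ContMDiffVectorBundle ∞ F (TangentSpace I : N → Type _) I :=
    TangentBundle.contMDiffVectorBundle (n := ∞)
  have hq' : q ∈ (chartAt H c).source := by rwa [extChartAt_source] at hq
  refine ((trivializationAt F (TangentSpace I) c).contMDiffAt_section_iff
    (s := coordField I c W) (by simpa using hq')).2 ?_
  have h1 : ContMDiffAt I 𝓘(ℝ, F) ∞ (fun q => W (extChartAt I c q)) q :=
    hW.contMDiffAt.comp q (contMDiffAt_extChartAt' hq')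
  refine h1.congr_of_eventuallyEq ?_
  filter_upwards [(chartAt H c).open_source.mem_nhds hq'] with x hx
  have hx' : x ∈ (extChartAt I c).source := by rwa [extChartAt_source]
  have h2 := DFunLike.congr_fun (TangentBundle.continuousLinearMapAt_trivializationAt (I := I) hx)
    (coordField I c W x)
  have h3 : (trivializationAt F (TangentSpace I) c).continuousLinearMapAt ℝ x (coordField I c W x) =
      (trivializationAt F (TangentSpace I) c ⟨x, coordField I c W x⟩).2 := by
    rw [Trivialization.continuousLinearMapAt_apply, Trivialization.coe_linearMapAt_of_mem]
    simpa using hx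
  exact h3.symm.trans (h2.trans (mfderiv_extChartAt_coordField hx' W))

end CoordField

/-! ### Coordinates on the tangent bundle. -/

section TangentChart

variable {E : Type v} [NormedAddCommGroup E] [NormedSpace ℝ E]
  {M : Type u} [TopologicalSpace M] [ChartedSpace E M] [IsManifold 𝓘(ℝ, E) ∞ M]

/-- The parametrization of `TM` over the domain of the preferred chart at `c`: the differential of
the inverse of the chart. -/
noncomputable def tmParam (c : M) (z : E × E) : TM E M :=
  ⟨(extChartAt 𝓘(ℝ, E) c).symm z.1, mfderiv 𝓘(ℝ, E) 𝓘(ℝ, E) (extChartAt 𝓘(ℝ, E) c).symm z.1 z.2⟩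

theorem mem_extChartAt_tangent_source {p q : TM E M} :
    q ∈ (extChartAt (JT E) p).source ↔ q.proj ∈ (extChartAt 𝓘(ℝ, E) p.proj).source := by
  rw [extChartAt_source, extChartAt_source]
  exact TangentBundle.mem_chart_source_iff q p

theorem mem_extChartAt_tangent_target {p : TM E M} {z : E × E} :
    z ∈ (extChartAt (JT E) p).target ↔ z.1 ∈ (extChartAt 𝓘(ℝ, E) p.proj).target := by
  rw [FiberBundle.extChartAt]
  simpa using fun h => (chartAt E p.proj).map_target h

/-- The inverse chart of `TM` at `p` depends only on the base point of `p`. The explicit map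
`tmParam` can thus replace it in all computations over the domain of a chart of `M`. -/
theorem extChartAt_tangent_symm_apply {p : TM E M} {z : E × E}
    (hz : z.1 ∈ (extChartAt 𝓘(ℝ, E) p.proj).target) :
    (extChartAt (JT E) p).symm z = tmParam p.proj z := by
  have : IsManifold 𝓘(ℝ, E) 1 M := .of_le (n := ∞) ENat.LEInfty.out
  have h := tangentMap_chart_symm (I := 𝓘(ℝ, E)) (p := p)
    (q := (⟨z.1, z.2⟩ : TangentBundle 𝓘(ℝ, E) E)) (by simpa using hz)
  exact h.symm

theorem extChartAt_tangent_apply {p q : TM E M}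
    (hq : q.proj ∈ (extChartAt 𝓘(ℝ, E) p.proj).source) :
    extChartAt (JT E) p q = (extChartAt 𝓘(ℝ, E) p.proj q.proj,
      mfderiv 𝓘(ℝ, E) 𝓘(ℝ, E) (extChartAt 𝓘(ℝ, E) p.proj) q.proj q.snd) := by
  have : IsManifold 𝓘(ℝ, E) 1 M := .of_le (n := ∞) ENat.LEInfty.out
  have h := tangentMap_chart (I := 𝓘(ℝ, E)) (p := p) (q := q) (by simpa using hq)
  have h' := congrArg (TotalSpace.toProd E E) h
  exact h'.symm

theorem eventuallyEq_tmParam {p : TM E M} {z : E × E}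
    (hz : z.1 ∈ (extChartAt 𝓘(ℝ, E) p.proj).target) :
    (extChartAt (JT E) p).symm =ᶠ[𝓝 z] tmParam p.proj := by
  have hopen : IsOpen (extChartAt (JT E) p).target := isOpen_extChartAt_target p
  filter_upwards [hopen.mem_nhds (mem_extChartAt_tangent_target.2 hz)] with w hw
  exact extChartAt_tangent_symm_apply (mem_extChartAt_tangent_target.1 hw)

theorem contMDiffAt_tmParam {c : M} {z : E × E} (hz : z.1 ∈ (extChartAt 𝓘(ℝ, E) c).target) :
    ContMDiffAt 𝓘(ℝ, E × E) (JT E) ∞ (tmParam c) z :=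
  (contMDiffAt_extChartAt_symm (I := JT E) (x := (⟨c, 0⟩ : TM E M))
    (mem_extChartAt_tangent_target.2 hz)).congr_of_eventuallyEq
    (eventuallyEq_tmParam (p := ⟨c, 0⟩) hz).symm

theorem mdifferentiableAt_tangent_proj (p : TM E M) :
    MDifferentiableAt (JT E) 𝓘(ℝ, E) (fun q : TM E M => q.proj) p :=
  (contMDiff_proj (n := ∞) (IB := 𝓘(ℝ, E)) (TangentSpace 𝓘(ℝ, E) : M → Type _)).mdifferentiable
    (by simp) p

theorem projDeriv_mfderiv_tmParam {c : M} {z : E × E}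
    (hz : z.1 ∈ (extChartAt 𝓘(ℝ, E) c).target) (ζ : E × E) :
    projDeriv (tmParam c z) (mfderiv 𝓘(ℝ, E × E) (JT E) (tmParam c) z ζ) =
      mfderiv 𝓘(ℝ, E) 𝓘(ℝ, E) (extChartAt 𝓘(ℝ, E) c).symm z.1 ζ.1 := by
  have h1 : mfderiv 𝓘(ℝ, E × E) 𝓘(ℝ, E) ((fun q : TM E M => q.proj) ∘ tmParam c) z =
      (projDeriv (tmParam c z)).comp (mfderiv 𝓘(ℝ, E × E) (JT E) (tmParam c) z) :=
    mfderiv_comp z (mdifferentiableAt_tangent_proj _)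
      ((contMDiffAt_tmParam hz).mdifferentiableAt (by simp))
  have h2 : mfderiv 𝓘(ℝ, E × E) 𝓘(ℝ, E) ((extChartAt 𝓘(ℝ, E) c).symm ∘ Prod.fst) z =
      (mfderiv 𝓘(ℝ, E) 𝓘(ℝ, E) (extChartAt 𝓘(ℝ, E) c).symm z.1).comp
        (mfderiv 𝓘(ℝ, E × E) 𝓘(ℝ, E) Prod.fst z) :=
    mfderiv_comp z (mdifferentiableAt_extChartAt_symm hz)
      (differentiableAt_fst.mdifferentiableAt)
  have h3 : mfderiv 𝓘(ℝ, E × E) 𝓘(ℝ, E) (Prod.fst : E × E → E) z = .fst ℝ E E := by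
    rw [mfderiv_eq_fderiv]; exact fderiv_fst
  rw [h3] at h2
  exact DFunLike.congr_fun (h1.symm.trans h2) ζ

theorem exists_eq_tmParam {p q : TM E M}
    (hq : q.proj ∈ (extChartAt 𝓘(ℝ, E) p.proj).source) :
    ∃ z : E × E, z.1 ∈ (extChartAt 𝓘(ℝ, E) p.proj).target ∧
      z.1 = extChartAt 𝓘(ℝ, E) p.proj q.proj ∧ tmParam p.proj z = q := by
  have hq' : q ∈ (extChartAt (JT E) p).source := mem_extChartAt_tangent_source.2 hq
  have ht := mem_extChartAt_tangent_target.1 ((extChartAt (JT E) p).map_source hq')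
  exact ⟨extChartAt (JT E) p q, ht, congrArg Prod.fst (extChartAt_tangent_apply hq),
    (extChartAt_tangent_symm_apply ht).symm.trans ((extChartAt (JT E) p).left_inv hq')⟩

theorem extChartAt_tangent_tmParam {p : TM E M} {z : E × E}
    (hz : z.1 ∈ (extChartAt 𝓘(ℝ, E) p.proj).target) :
    extChartAt (JT E) p (tmParam p.proj z) = z :=
  (congrArg (extChartAt (JT E) p) (extChartAt_tangent_symm_apply hz).symm).trans
    ((extChartAt (JT E) p).right_inv (mem_extChartAt_tangent_target.2 hz))

theorem coordField_tmParam {p : TM E M} {z : E × E}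
    (hz : z.1 ∈ (extChartAt 𝓘(ℝ, E) p.proj).target)
    (W : E × E → E × E) : coordField (JT E) p W (tmParam p.proj z) =
      mfderiv 𝓘(ℝ, E × E) (JT E) (tmParam p.proj) z (W z) := by
  have h : (mfderiv 𝓘(ℝ, E × E) (JT E) (extChartAt (JT E) p).symm z :
      E × E →L[ℝ] E × E) = mfderiv 𝓘(ℝ, E × E) (JT E) (tmParam p.proj) z :=
    (eventuallyEq_tmParam hz).mfderiv_eq
  unfold coordField
  rw [extChartAt_tangent_tmParam hz]
  exact DFunLike.congr_fun h (W z)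

theorem exists_eq_mfderiv_tmParam {c : M} {z : E × E}
    (hz : z.1 ∈ (extChartAt 𝓘(ℝ, E) c).target) (ξ : TangentSpace (JT E) (tmParam c z)) :
    ∃ ζ : E × E, mfderiv 𝓘(ℝ, E × E) (JT E) (tmParam c) z ζ = ξ := by
  let p : TM E M := ⟨c, 0⟩
  have hsrc : tmParam c z ∈ (extChartAt (JT E) p).source :=
    mem_extChartAt_tangent_source.2 ((extChartAt 𝓘(ℝ, E) c).map_target hz)
  let ζ : E × E := mfderiv (JT E) 𝓘(ℝ, E × E) (extChartAt (JT E) p) (tmParam c z) ξ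
  exact ⟨ζ, (coordField_tmParam (p := p) hz (fun _ => ζ)).symm.trans
    (mfderiv_extChartAt_symm_apply_mfderiv hsrc ξ)⟩

end TangentChart

/-! ### Metric, Liouville form and symplectic form in coordinates. -/

section InChart

variable {F : Type*} [NormedAddCommGroup F] [NormedSpace ℝ F] [FiniteDimensional ℝ F]
  {H : Type*} [TopologicalSpace H] {I : ModelWithCorners ℝ F H} [I.Boundaryless]
  {N : Type*} [TopologicalSpace N] [ChartedSpace H N] [IsManifold I ∞ N]

/-- In finite dimension smoothness of a covector field can be tested on constant vectors, and these
are the coordinate fields of the chart. -/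
theorem OneForm.IsSmooth.contDiffOn_inChart {β : OneForm I (N := N)} (hβ : β.IsSmooth I) (c : N) :
    ContDiffOn ℝ ∞ (β.inChart I c) (extChartAt I c).target := by
  refine contDiffOn_clm_apply.2 fun v z hz => ContDiffAt.contDiffWithinAt ?_
  have hq := (extChartAt I c).map_target hz
  have h1 : ContMDiffAt I (I.prod 𝓘(ℝ)) ∞
      (fun q : N => TotalSpace.mk' ℝ (E := Bundle.Trivial N ℝ) q
        (β q (coordField I c (fun _ => v) q))) ((extChartAt I c).symm z) :=
    ContMDiffAt.clm_bundle_apply (F₁ := F) (F₂ := ℝ) (E₁ := TangentSpace I)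
      (E₂ := Bundle.Trivial N ℝ) (hβ _) (contMDiffAt_coordField hq contDiffAt_const)
  rw [contMDiffAt_totalSpace] at h1
  have h2 : ContMDiffAt I 𝓘(ℝ, ℝ) ∞ (fun q : N => β q (coordField I c (fun _ => v) q))
      ((extChartAt I c).symm z) := h1.2
  refine (h2.comp z (contMDiffAt_extChartAt_symm hz)).contDiffAt.congr_of_eventuallyEq ?_
  filter_upwards [(isOpen_extChartAt_target c).mem_nhds hz] with w hw
  simp only [OneForm.inChart, coordField, Function.comp_apply]
  rw [(extChartAt I c).right_inv hw]
  rfl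

end InChart

section Metric

variable {E : Type v} [NormedAddCommGroup E] [NormedSpace ℝ E]
  {M : Type u} [TopologicalSpace M] [ChartedSpace E M] [IsManifold 𝓘(ℝ, E) ∞ M]

namespace PseudoRiemannianMetric

variable (g : PseudoRiemannianMetric E M)

/-- The expression of the metric in the preferred chart at `c`. -/
noncomputable def inChart (c : M) (y : E) : E →L[ℝ] E →L[ℝ] ℝ :=
  let A : E →L[ℝ] E := mfderiv 𝓘(ℝ, E) 𝓘(ℝ, E) (extChartAt 𝓘(ℝ, E) c).symm y
  let B : E →L[ℝ] E →L[ℝ] ℝ := g.form ((extChartAt 𝓘(ℝ, E) c).symm y)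
  B.bilinearComp A A

theorem inChart_apply (c : M) (y v w : E) : g.inChart c y v w =
    g.form ((extChartAt 𝓘(ℝ, E) c).symm y)
      (mfderiv 𝓘(ℝ, E) 𝓘(ℝ, E) (extChartAt 𝓘(ℝ, E) c).symm y v)
      (mfderiv 𝓘(ℝ, E) 𝓘(ℝ, E) (extChartAt 𝓘(ℝ, E) c).symm y w) := rfl

theorem inChart_symm (c : M) (y v w : E) : g.inChart c y v w = g.inChart c y w v :=
  g.symm ((extChartAt 𝓘(ℝ, E) c).symm y) (mfderiv 𝓘(ℝ, E) 𝓘(ℝ, E) (extChartAt 𝓘(ℝ, E) c).symm y v)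
    (mfderiv 𝓘(ℝ, E) 𝓘(ℝ, E) (extChartAt 𝓘(ℝ, E) c).symm y w)

theorem inChart_nondegenerate {c : M} {y : E} (hy : y ∈ (extChartAt 𝓘(ℝ, E) c).target) {v : E}
    (h : ∀ w, g.inChart c y v w = 0) : v = 0 := by
  refine eq_zero_of_mfderiv_extChartAt_symm_eq_zero hy (g.nondegenerate _ _ fun ξ => ?_)
  obtain ⟨w, rfl⟩ := exists_mfderiv_extChartAt_symm_eq hy ξ
  exact h w

theorem contDiffOn_inChart [FiniteDimensional ℝ E] (c : M) :
    ContDiffOn ℝ ∞ (g.inChart c) (extChartAt 𝓘(ℝ, E) c).target := by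
  refine contDiffOn_clm_apply.2 fun v => contDiffOn_clm_apply.2 fun w z hz =>
    ContDiffAt.contDiffWithinAt ?_
  have hq := (extChartAt 𝓘(ℝ, E) c).map_target hz
  have h1 : ContMDiffAt 𝓘(ℝ, E) (𝓘(ℝ, E).prod 𝓘(ℝ)) ∞
      (fun q : M => TotalSpace.mk' ℝ (E := Bundle.Trivial M ℝ) q
        (g.form q (coordField 𝓘(ℝ, E) c (fun _ => v) q) (coordField 𝓘(ℝ, E) c (fun _ => w) q)))
      ((extChartAt 𝓘(ℝ, E) c).symm z) :=
    ContMDiffAt.clm_bundle_apply₂ (F₁ := E) (F₂ := E) (F₃ := ℝ) (E₁ := TangentSpace 𝓘(ℝ, E))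
      (E₂ := TangentSpace 𝓘(ℝ, E)) (E₃ := Bundle.Trivial M ℝ) (g.smooth _)
      (contMDiffAt_coordField hq contDiffAt_const) (contMDiffAt_coordField hq contDiffAt_const)
  rw [contMDiffAt_totalSpace] at h1
  have h2 : ContMDiffAt 𝓘(ℝ, E) 𝓘(ℝ, ℝ) ∞ (fun q : M => g.form q
      (coordField 𝓘(ℝ, E) c (fun _ => v) q) (coordField 𝓘(ℝ, E) c (fun _ => w) q))
      ((extChartAt 𝓘(ℝ, E) c).symm z) := h1.2
  refine (h2.comp z (contMDiffAt_extChartAt_symm hz)).contDiffAt.congr_of_eventuallyEq ?_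
  filter_upwards [(isOpen_extChartAt_target c).mem_nhds hz] with y hy
  simp only [inChart_apply, coordField, Function.comp_apply]
  rw [(extChartAt 𝓘(ℝ, E) c).right_inv hy]

theorem contDiffAt_inChart [FiniteDimensional ℝ E] {c : M} {y : E}
    (hy : y ∈ (extChartAt 𝓘(ℝ, E) c).target) : ContDiffAt ℝ ∞ (g.inChart c) y :=
  (g.contDiffOn_inChart c).contDiffAt ((isOpen_extChartAt_target c).mem_nhds hy)

/-- Nondegeneracy gives injectivity, and `E` has the dimension of its dual. -/
theorem isInvertible_inChart [FiniteDimensional ℝ E] {c : M} {y : E}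
    (hy : y ∈ (extChartAt 𝓘(ℝ, E) c).target) : (g.inChart c y).IsInvertible := by
  have hinj : Function.Injective (g.inChart c y) := by
    refine (injective_iff_map_eq_zero _).2 fun v hv => g.inChart_nondegenerate hy fun w => ?_
    rw [hv]
    rfl
  have hdim : Module.finrank ℝ E = Module.finrank ℝ (E →L[ℝ] ℝ) := by
    rw [← LinearMap.toContinuousLinearMap.finrank_eq]
    exact (Subspace.dual_finrank_eq (K := ℝ) (V := E)).symm
  refine ⟨(LinearEquiv.ofInjectiveOfFinrankEq (g.inChart c y).toLinearMap hinj
    hdim).toContinuousLinearEquiv, ?_⟩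
  ext
  rfl

variable {g}

theorem liouville_pullback_tmParam {c : M} {z : E × E}
    (hz : z.1 ∈ (extChartAt 𝓘(ℝ, E) c).target) :
    g.liouville.pullback (JT E) (tmParam c) z = (g.inChart c z.1 z.2).comp (.fst ℝ E E) := by
  refine ContinuousLinearMap.ext fun ζ => ?_
  have h := projDeriv_mfderiv_tmParam hz ζ
  change g.form (tmParam c z).proj (tmParam c z).snd
    (projDeriv (tmParam c z) (mfderiv 𝓘(ℝ, E × E) (JT E) (tmParam c) z ζ)) = _
  rw [h]
  rfl

theorem eventuallyEq_liouville_pullback_tmParam {c : M} {z : E × E}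
    (hz : z.1 ∈ (extChartAt 𝓘(ℝ, E) c).target) :
    g.liouville.pullback (JT E) (tmParam c) =ᶠ[𝓝 z]
      fun z => (g.inChart c z.1 z.2).comp (.fst ℝ E E) := by
  have h : ∀ᶠ z' : E × E in 𝓝 z, z'.1 ∈ (extChartAt 𝓘(ℝ, E) c).target :=
    continuousAt_fst.eventually ((isOpen_extChartAt_target c).mem_nhds hz)
  exact h.mono fun z' hz' => liouville_pullback_tmParam hz'

theorem eventuallyEq_liouville_inChart {p : TM E M} {z : E × E}
    (hz : z.1 ∈ (extChartAt 𝓘(ℝ, E) p.proj).target) :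
    g.liouville.inChart (JT E) p =ᶠ[𝓝 z]
      fun z => (g.inChart p.proj z.1 z.2).comp (.fst ℝ E E) := by
  refine Filter.EventuallyEq.trans ?_ (eventuallyEq_liouville_pullback_tmParam hz)
  filter_upwards [(eventuallyEq_tmParam hz).eventuallyEq_nhds] with w hw
  have h1 := hw.eq_of_nhds
  have h2 : (mfderiv 𝓘(ℝ, E × E) (JT E) (extChartAt (JT E) p).symm w : E × E →L[ℝ] E × E) =
      mfderiv 𝓘(ℝ, E × E) (JT E) (tmParam p.proj) w := hw.mfderiv_eq
  refine ContinuousLinearMap.ext fun ζ => ?_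
  change (g.liouville ((extChartAt (JT E) p).symm w) : E × E →L[ℝ] ℝ)
    ((mfderiv 𝓘(ℝ, E × E) (JT E) (extChartAt (JT E) p).symm w : E × E →L[ℝ] E × E) ζ) = _
  rw [h2, h1]
  rfl

theorem hasFDerivAt_liouville_coord [FiniteDimensional ℝ E] {c : M} {z : E × E}
    (hz : z.1 ∈ (extChartAt 𝓘(ℝ, E) c).target) :
    DifferentiableAt ℝ (fun z : E × E => (g.inChart c z.1 z.2).comp (.fst ℝ E E)) z ∧
    ∀ ζ η : E × E, fderiv ℝ (fun z : E × E => (g.inChart c z.1 z.2).comp (.fst ℝ E E)) z ζ η =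
      fderiv ℝ (g.inChart c) z.1 ζ.1 z.2 η.1 + g.inChart c z.1 ζ.2 η.1 := by
  have h1 : HasFDerivAt (fun z : E × E => g.inChart c z.1) _ z :=
    HasFDerivAt.comp (g := g.inChart c) z
      ((g.contDiffAt_inChart hz).differentiableAt (by simp)).hasFDerivAt hasFDerivAt_fst
  have h2 := h1.clm_apply (hasFDerivAt_snd (𝕜 := ℝ) (p := z))
  have h3 := h2.clm_comp (hasFDerivAt_const (ContinuousLinearMap.fst ℝ E E) z)
  refine ⟨h3.differentiableAt, fun ζ η => ?_⟩
  rw [h3.fderiv]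
  simp [add_comm]

/-- This supplies the differentiability hypothesis of `OneForm.extDeriv_mfderiv`, so that the
symplectic form can be computed through any smooth map into `TM`. -/
theorem differentiableAt_liouville_inChart [FiniteDimensional ℝ E] (p : TM E M) :
    DifferentiableAt ℝ (g.liouville.inChart (JT E) p) (extChartAt (JT E) p p) := by
  have hz : (extChartAt (JT E) p p).1 ∈ (extChartAt 𝓘(ℝ, E) p.proj).target :=
    mem_extChartAt_tangent_target.1 (mem_extChartAt_target p)
  exact (hasFDerivAt_liouville_coord hz).1.congr_of_eventuallyEq
    (eventuallyEq_liouville_inChart hz)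

theorem symplecticForm_mfderiv [FiniteDimensional ℝ E] {V : Type*} [NormedAddCommGroup V]
    [NormedSpace ℝ V] {f : V → TM E M} {y : V} (hf : ContMDiffAt 𝓘(ℝ, V) (JT E) ∞ f y) (a b : V) :
    g.symplecticForm (f y) (mfderiv 𝓘(ℝ, V) (JT E) f y a) (mfderiv 𝓘(ℝ, V) (JT E) f y b) =
      fderiv ℝ (g.liouville.pullback (JT E) f) y a b -
        fderiv ℝ (g.liouville.pullback (JT E) f) y b a :=
  OneForm.extDeriv_mfderiv (differentiableAt_liouville_inChart (f y)) hf a b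

theorem symplecticForm_tmParam [FiniteDimensional ℝ E] {c : M} {z : E × E}
    (hz : z.1 ∈ (extChartAt 𝓘(ℝ, E) c).target) (ζ η : E × E) :
    g.symplecticForm (tmParam c z) (mfderiv 𝓘(ℝ, E × E) (JT E) (tmParam c) z ζ)
      (mfderiv 𝓘(ℝ, E × E) (JT E) (tmParam c) z η) =
      fderiv ℝ (g.inChart c) z.1 ζ.1 z.2 η.1 + g.inChart c z.1 ζ.2 η.1 -
        (fderiv ℝ (g.inChart c) z.1 η.1 z.2 ζ.1 + g.inChart c z.1 η.2 ζ.1) := by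
  rw [symplecticForm_mfderiv (contMDiffAt_tmParam hz),
    (eventuallyEq_liouville_pullback_tmParam hz).fderiv_eq, (hasFDerivAt_liouville_coord hz).2,
    (hasFDerivAt_liouville_coord hz).2]

end PseudoRiemannianMetric
end Metric

theorem contDiffAt_fderiv_fst_apply_snd {F G : Type*} [NormedAddCommGroup F] [NormedSpace ℝ F]
    [NormedAddCommGroup G] [NormedSpace ℝ G] {f : F → G} {z : F × F} (hf : ContDiffAt ℝ ∞ f z.1) :
    ContDiffAt ℝ ∞ (fun z : F × F => fderiv ℝ f z.1 z.2) z :=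
  (ContDiffAt.comp (g := fderiv ℝ f) z (contDiffAt_fderiv_infty hf) contDiffAt_fst).clm_apply
    contDiffAt_snd

/-! ### Newton's equation in coordinates. -/

section Newton

variable {E : Type v} [NormedAddCommGroup E] [NormedSpace ℝ E]
  {M : Type u} [TopologicalSpace M] [ChartedSpace E M] [IsManifold 𝓘(ℝ, E) ∞ M]

namespace PseudoRiemannianMetric

variable {g : PseudoRiemannianMetric E M}

theorem symplecticForm_sub_left (p : TM E M) (ξ ξ' η : TangentSpace (JT E) p) :
    g.symplecticForm p (ξ - ξ') η = g.symplecticForm p ξ η - g.symplecticForm p ξ' η := by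
  have key : ∀ (T : E × E →L[ℝ] E × E →L[ℝ] ℝ) (x x' y : E × E),
      T (x - x') y - T y (x - x') = T x y - T y x - (T x' y - T y x') := by
    intro T x x' y
    rw [map_sub, map_sub, _root_.sub_apply]
    ring
  have hsub := map_sub (mfderiv (JT E) 𝓘(ℝ, E × E) (extChartAt (JT E) p) p) ξ ξ'
  unfold symplecticForm OneForm.extDeriv
  rw [hsub]
  exact key (fderiv ℝ (g.liouville.inChart (JT E) p) (extChartAt (JT E) p p)) _ _ _

theorem hasFDerivAt_kineticEnergy_tmParam [FiniteDimensional ℝ E] {c : M} {z : E × E}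
    (hz : z.1 ∈ (extChartAt 𝓘(ℝ, E) c).target) :
    ContDiffAt ℝ ∞ (fun z => g.kineticEnergy (tmParam c z)) z ∧
    ∀ ζ : E × E, fderiv ℝ (fun z => g.kineticEnergy (tmParam c z)) z ζ =
      (1 / 2 : ℝ) * fderiv ℝ (g.inChart c) z.1 ζ.1 z.2 z.2 + g.inChart c z.1 ζ.2 z.2 := by
  have h0 : ContDiffAt ℝ ∞ (fun z : E × E => g.inChart c z.1) z :=
    ContDiffAt.comp (g := g.inChart c) z (g.contDiffAt_inChart hz) contDiffAt_fst
  refine ⟨contDiffAt_const.mul ((h0.clm_apply contDiffAt_snd).clm_apply contDiffAt_snd),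
    fun ζ => ?_⟩
  have h1 : HasFDerivAt (fun z : E × E => g.inChart c z.1) _ z :=
    HasFDerivAt.comp (g := g.inChart c) z
      ((g.contDiffAt_inChart hz).differentiableAt (by simp)).hasFDerivAt hasFDerivAt_fst
  have h2 := ((h1.clm_apply (hasFDerivAt_snd (𝕜 := ℝ) (p := z))).clm_apply
    (hasFDerivAt_snd (𝕜 := ℝ) (p := z))).const_mul (1 / 2 : ℝ)
  have h3 : HasFDerivAt (fun z => g.kineticEnergy (tmParam c z)) _ z := h2
  rw [h3.fderiv]
  simp
  -- Symmetry merges the two terms from the fibre derivative, which cancels the factor `1 / 2`.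
  rw [g.inChart_symm c z.1 z.2 ζ.2]
  ring

theorem contMDiff_kineticEnergy [FiniteDimensional ℝ E] :
    ContMDiff (JT E) 𝓘(ℝ, ℝ) ∞ g.kineticEnergy := by
  intro p
  have hz : (extChartAt (JT E) p p).1 ∈ (extChartAt 𝓘(ℝ, E) p.proj).target :=
    mem_extChartAt_tangent_target.1 (mem_extChartAt_target p)
  refine ((hasFDerivAt_kineticEnergy_tmParam (g := g) hz).1.contMDiffAt.comp p
    (contMDiffAt_extChartAt (I := JT E))).congr_of_eventuallyEq ?_
  filter_upwards [extChartAt_source_mem_nhds (I := JT E) p] with q hq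
  have ht := mem_extChartAt_tangent_target.1 ((extChartAt (JT E) p).map_source hq)
  exact congrArg g.kineticEnergy (((extChartAt (JT E) p).left_inv hq).symm.trans
    (extChartAt_tangent_symm_apply ht))

theorem differential_kineticEnergy_tmParam [FiniteDimensional ℝ E] {c : M} {z : E × E}
    (hz : z.1 ∈ (extChartAt 𝓘(ℝ, E) c).target) (ζ : E × E) :
    differential (JT E) g.kineticEnergy (tmParam c z)
      (mfderiv 𝓘(ℝ, E × E) (JT E) (tmParam c) z ζ) =
      (1 / 2 : ℝ) * fderiv ℝ (g.inChart c) z.1 ζ.1 z.2 z.2 + g.inChart c z.1 ζ.2 z.2 := by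
  rw [← (hasFDerivAt_kineticEnergy_tmParam (g := g) hz).2, ← mfderiv_eq_fderiv]
  have h := mfderiv_comp z ((contMDiff_kineticEnergy (g := g)).mdifferentiable (by simp)
    (tmParam c z)) ((contMDiffAt_tmParam hz).mdifferentiableAt (by simp))
  exact (DFunLike.congr_fun h ζ).symm

set_option synthInstance.maxHeartbeats 400000 in
/-- A vertical vector which is orthogonal, for the symplectic form, to vectors with arbitrary
projections vanishes. -/
theorem eq_zero_of_vertical [FiniteDimensional ℝ E] {p : TM E M} {ξ : TangentSpace (JT E) p}
    (hξ : projDeriv p ξ = 0)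
    (h : ∀ v, ∃ η, projDeriv p η = v ∧ g.symplecticForm p ξ η = 0) : ξ = 0 := by
  obtain ⟨c, hc⟩ : ∃ c, p.proj ∈ (extChartAt 𝓘(ℝ, E) c).source :=
    ⟨p.proj, mem_extChartAt_source _⟩
  obtain ⟨z, hz, -, rfl⟩ := exists_eq_tmParam (p := (⟨c, 0⟩ : TM E M)) hc
  change z.1 ∈ (extChartAt 𝓘(ℝ, E) c).target at hz
  dsimp only at h hξ ξ
  obtain ⟨ζ, rfl⟩ := exists_eq_mfderiv_tmParam hz ξ
  rw [projDeriv_mfderiv_tmParam hz] at hξ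
  have h1 : ζ.1 = 0 := eq_zero_of_mfderiv_extChartAt_symm_eq_zero hz hξ
  -- For a vertical vector the symplectic form reduces to `g (ζ.2, η.1)`, so only the projection of
  -- `η` matters, and it is arbitrary.
  have h2 : ζ.2 = 0 := by
    refine g.inChart_nondegenerate hz fun w => ?_
    obtain ⟨η, hη, hs⟩ := h (mfderiv 𝓘(ℝ, E) 𝓘(ℝ, E) (extChartAt 𝓘(ℝ, E) c).symm z.1 w)
    obtain ⟨η, rfl⟩ := exists_eq_mfderiv_tmParam hz η
    rw [projDeriv_mfderiv_tmParam hz] at hη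
    have h3 : η.1 = w := by
      rw [← sub_eq_zero]
      refine eq_zero_of_mfderiv_extChartAt_symm_eq_zero hz ?_
      exact (map_sub (mfderiv 𝓘(ℝ, E) 𝓘(ℝ, E) (extChartAt 𝓘(ℝ, E) c).symm z.1) η.1 w).trans
        (sub_eq_zero.2 hη)
    rw [symplecticForm_tmParam hz, h1, h3, map_zero, map_zero, map_zero] at hs
    simpa only [zero_add, _root_.zero_apply, add_zero, sub_zero] using hs
  have h3 : ζ = 0 := Prod.ext h1 h2
  exact (congrArg (mfderiv 𝓘(ℝ, E × E) (JT E) (tmParam c) z) h3).trans (map_zero _)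

end PseudoRiemannianMetric

variable (g : PseudoRiemannianMetric E M) (a : OneForm 𝓘(ℝ, E) (N := M))

/-- The expression in the preferred chart at `c` of the force in Newton's equation for the work
form `π^* a`. -/
noncomputable def force (c : M) (z : E × E) : E →L[ℝ] ℝ :=
  (fderiv ℝ (fun z => g.kineticEnergy (tmParam c z)) z).comp (.inl ℝ E E) -
    fderiv ℝ (g.inChart c) z.1 z.2 z.2 - a.inChart 𝓘(ℝ, E) c z.1

/-- The acceleration prescribed by Newton's equation for the work form `π^* a`, in the preferred
chart at `c`. -/
noncomputable def acceleration (c : M) (z : E × E) : E :=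
  (g.inChart c z.1).inverse (force g a c z)

variable {g a}

/-- These are the Euler–Lagrange equations of the kinetic energy with force `-a`, with the index of
the acceleration lowered by the metric. -/
theorem inChart_acceleration [FiniteDimensional ℝ E] {c : M} {z : E × E}
    (hz : z.1 ∈ (extChartAt 𝓘(ℝ, E) c).target) (e : E) :
    g.inChart c z.1 (acceleration g a c z) e = (1 / 2 : ℝ) * fderiv ℝ (g.inChart c) z.1 e z.2 z.2 -
      fderiv ℝ (g.inChart c) z.1 z.2 z.2 e - a.inChart 𝓘(ℝ, E) c z.1 e := by
  have h := (PseudoRiemannianMetric.hasFDerivAt_kineticEnergy_tmParam (g := g) hz).2 (e, 0)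
  rw [map_zero, _root_.zero_apply, add_zero] at h
  rw [acceleration, (g.isInvertible_inChart hz).self_apply_inverse, ← h]
  rfl

theorem contDiffAt_acceleration [FiniteDimensional ℝ E] (ha : a.IsSmooth 𝓘(ℝ, E)) {c : M}
    {z : E × E} (hz : z.1 ∈ (extChartAt 𝓘(ℝ, E) c).target) :
    ContDiffAt ℝ ∞ (acceleration g a c) z := by
  have := FiniteDimensional.complete ℝ E
  have hG : ContDiffAt ℝ ∞ (fun z : E × E => g.inChart c z.1) z :=
    ContDiffAt.comp (g := g.inChart c) z (g.contDiffAt_inChart hz) contDiffAt_fst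
  have hA : ContDiffAt ℝ ∞ (fun z : E × E => a.inChart 𝓘(ℝ, E) c z.1) z :=
    ContDiffAt.comp (g := a.inChart 𝓘(ℝ, E) c) z ((ha.contDiffOn_inChart c).contDiffAt
      ((isOpen_extChartAt_target c).mem_nhds hz)) contDiffAt_fst
  have hinv : ContDiffAt ℝ ∞ (fun z : E × E => (g.inChart c z.1).inverse) z :=
    ContDiffAt.comp (g := ContinuousLinearMap.inverse) z
      (g.isInvertible_inChart hz).contDiffAt_map_inverse hG
  have hK := contDiffAt_fderiv_infty
    (PseudoRiemannianMetric.hasFDerivAt_kineticEnergy_tmParam (g := g) hz).1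
  have h1 : ContDiffAt ℝ ∞ (fun z : E × E => fderiv ℝ (g.inChart c) z.1 z.2) z :=
    contDiffAt_fderiv_fst_apply_snd (g.contDiffAt_inChart hz)
  have h2 : ContDiffAt ℝ ∞ (fun z : E × E => fderiv ℝ (g.inChart c) z.1 z.2 z.2) z :=
    ContDiffAt.clm_apply (F := E) (G := E →L[ℝ] ℝ) h1 contDiffAt_snd
  exact hinv.clm_apply (((hK.clm_comp contDiffAt_const).sub h2).sub hA)

end Newton

/-! ### Existence and uniqueness of the equation of motion. -/

section EquationOfMotion

variable {E : Type v} [NormedAddCommGroup E] [NormedSpace ℝ E] [FiniteDimensional ℝ E]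
  {M : Type u} [TopologicalSpace M] [ChartedSpace E M] [IsManifold 𝓘(ℝ, E) ∞ M]

/-- The solution of Newton's equation for the work form `π^* a`, in the preferred chart at `p`. -/
noncomputable def newtonField (g : PseudoRiemannianMetric E M) (a : OneForm 𝓘(ℝ, E) (N := M))
    (p q : TM E M) : TangentSpace (JT E) q :=
  coordField (JT E) p (fun z : E × E => (z.2, acceleration g a p.proj z)) q

variable {g : PseudoRiemannianMetric E M} {a : OneForm 𝓘(ℝ, E) (N := M)}

/-- The centre `p` of the chart is kept separate from the point `q`, so that solutions computed in
different charts can be compared at the same point. -/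
theorem newtonField_spec {p q : TM E M} (hq : q.proj ∈ (extChartAt 𝓘(ℝ, E) p.proj).source) :
    projDeriv q (newtonField g a p q) = q.snd ∧ ∀ ξ, g.symplecticForm q (newtonField g a p q) ξ +
      differential (JT E) g.kineticEnergy q ξ + a q.proj (projDeriv q ξ) = 0 := by
  obtain ⟨z, hz, -, rfl⟩ := exists_eq_tmParam hq
  unfold newtonField
  rw [coordField_tmParam hz]
  refine ⟨projDeriv_mfderiv_tmParam hz _, fun ξ => ?_⟩
  obtain ⟨η, rfl⟩ := exists_eq_mfderiv_tmParam hz ξ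
  rw [PseudoRiemannianMetric.symplecticForm_tmParam hz,
    PseudoRiemannianMetric.differential_kineticEnergy_tmParam hz, projDeriv_mfderiv_tmParam hz,
    inChart_acceleration hz]
  have h : a (tmParam p.proj z).proj
      (mfderiv 𝓘(ℝ, E) 𝓘(ℝ, E) (extChartAt 𝓘(ℝ, E) p.proj).symm z.1 η.1) =
      a.inChart 𝓘(ℝ, E) p.proj z.1 η.1 := rfl
  rw [h]
  ring

/-- The difference of the two vectors is vertical and orthogonal to everything for the symplectic
form. -/
theorem eq_of_newton {p : TM E M} {ξ ξ' : TangentSpace (JT E) p}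
    (hξ : projDeriv p ξ = projDeriv p ξ')
    (h : ∀ η, g.symplecticForm p ξ η = g.symplecticForm p ξ' η) : ξ = ξ' := by
  refine sub_eq_zero.1 (PseudoRiemannianMetric.eq_zero_of_vertical (g := g) ?_ fun v => ?_)
  · rw [map_sub, hξ, sub_self]
  · obtain ⟨c, hc⟩ : ∃ c, p.proj ∈ (extChartAt 𝓘(ℝ, E) c).source :=
      ⟨p.proj, mem_extChartAt_source _⟩
    obtain ⟨z, hz, -, rfl⟩ := exists_eq_tmParam (p := (⟨c, 0⟩ : TM E M)) hc
    obtain ⟨w, rfl⟩ := exists_mfderiv_extChartAt_symm_eq hz v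
    refine ⟨mfderiv 𝓘(ℝ, E × E) (JT E) (tmParam c) z (w, 0), projDeriv_mfderiv_tmParam hz _, ?_⟩
    rw [PseudoRiemannianMetric.symplecticForm_sub_left, h, sub_self]

theorem contMDiffAt_newtonField (ha : a.IsSmooth 𝓘(ℝ, E)) {p q : TM E M}
    (hq : q.proj ∈ (extChartAt 𝓘(ℝ, E) p.proj).source) :
    ContMDiffAt (JT E) (JT E).tangent ∞
      (fun q => (⟨q, newtonField g a p q⟩ : TangentBundle (JT E) (TM E M))) q := by
  refine contMDiffAt_coordField (mem_extChartAt_tangent_source.2 hq)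
    (contDiffAt_snd.prodMk (contDiffAt_acceleration ha ?_))
  exact mem_extChartAt_tangent_target.1
    ((extChartAt (JT E) p).map_source (mem_extChartAt_tangent_source.2 hq))

theorem MechanicalSystem.exists_isEquationOfMotion (S : MechanicalSystem E M)
    (ha : a.IsSmooth 𝓘(ℝ, E)) (hS : ∀ p, S.work p = (a p.proj).comp (projDeriv p)) :
    ∃ D, S.IsEquationOfMotion D := by
  have hspec : ∀ q : TM E M, _ := fun q =>
    newtonField_spec (g := S.metric) (a := a) (p := q) (mem_extChartAt_source q.proj)
  -- The field at `q` is computed in the chart at `q` itself. Near `p` uniqueness replaces this by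
  -- the chart at `p`, in which smoothness is visible.
  refine ⟨fun q => newtonField S.metric a q q, ⟨fun p => ?_, fun q => (hspec q).1⟩, fun q ξ => ?_⟩
  · refine (contMDiffAt_newtonField (g := S.metric) ha
      (mem_extChartAt_source p.proj)).congr_of_eventuallyEq ?_
    have hmem : ∀ᶠ q : TM E M in 𝓝 p, q.proj ∈ (extChartAt 𝓘(ℝ, E) p.proj).source :=
      (mdifferentiableAt_tangent_proj p).continuousAt.eventually
        (extChartAt_source_mem_nhds (I := 𝓘(ℝ, E)) p.proj)
    filter_upwards [hmem] with q hq
    have h := newtonField_spec (g := S.metric) (a := a) hq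
    have h' := eq_of_newton (g := S.metric) ((hspec q).1.trans h.1.symm) fun η => by
      linarith [(hspec q).2 η, h.2 η]
    rw [h']
  · rw [hS]
    exact (hspec q).2 ξ

end EquationOfMotion

/-! ### Potentials of the work form and Lagrangian intermediate integrals. -/

section Conservative

variable {E : Type v} [NormedAddCommGroup E] [NormedSpace ℝ E]
  {M : Type u} [TopologicalSpace M] [ChartedSpace E M] [IsManifold 𝓘(ℝ, E) ∞ M]
  {X : (x : M) → TangentSpace 𝓘(ℝ, E) x} {O : Set M} {x : M}

theorem projDeriv_sectionDeriv (hX : MDifferentiableAt 𝓘(ℝ, E) (JT E) (toSection X) x)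
    (v : TangentSpace 𝓘(ℝ, E) x) : projDeriv (toSection X x) (sectionDeriv X x v) = v := by
  have h := mfderiv_comp x (mdifferentiableAt_tangent_proj (toSection X x)) hX
  have h' : mfderiv 𝓘(ℝ, E) 𝓘(ℝ, E) (fun x : M => x) x = .id ℝ _ := mfderiv_id
  exact DFunLike.congr_fun (h.symm.trans h') v

theorem mfderiv_comp_toSection {f : TM E M → ℝ}
    (hf : MDifferentiableAt (JT E) 𝓘(ℝ, ℝ) f (toSection X x))
    (hX : MDifferentiableAt 𝓘(ℝ, E) (JT E) (toSection X) x) (v : TangentSpace 𝓘(ℝ, E) x) :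
    differential 𝓘(ℝ, E) (fun x => f (toSection X x)) x v =
      differential (JT E) f (toSection X x) (sectionDeriv X x v) :=
  DFunLike.congr_fun (mfderiv_comp x hf hX) v

theorem differential_comp_proj {f : M → ℝ} {p : TM E M}
    (hf : MDifferentiableAt 𝓘(ℝ, E) 𝓘(ℝ, ℝ) f p.proj) :
    differential (JT E) (fun q : TM E M => f q.proj) p =
      (differential 𝓘(ℝ, E) f p.proj).comp (projDeriv p) :=
  mfderiv_comp p hf (mdifferentiableAt_tangent_proj p)

theorem contMDiff_tangent_proj :
    ContMDiff (JT E) 𝓘(ℝ, E) ∞ (fun q : TM E M => q.proj) :=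
  contMDiff_proj (n := ∞) (IB := 𝓘(ℝ, E)) (TangentSpace 𝓘(ℝ, E) : M → Type _)

theorem contMDiff_toSection_zero :
    ContMDiff 𝓘(ℝ, E) (JT E) ∞ (toSection (0 : (x : M) → TangentSpace 𝓘(ℝ, E) x)) :=
  Bundle.contMDiff_zeroSection ℝ (TangentSpace 𝓘(ℝ, E) : M → Type _)

namespace MechanicalSystem

variable {S : MechanicalSystem E M} {a : OneForm 𝓘(ℝ, E) (N := M)}

theorem isConservativeOn_of_eq_differential (hO : IsOpen O)
    (hS : ∀ p, S.work p = (a p.proj).comp (projDeriv p)) {f : M → ℝ}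
    (hf : ContMDiffOn 𝓘(ℝ, E) 𝓘(ℝ, ℝ) ∞ f O) (haf : ∀ x ∈ O, a x = differential 𝓘(ℝ, E) f x) :
    S.IsConservativeOn O := by
  refine ⟨fun q => f q.proj, hf.comp contMDiff_tangent_proj.contMDiffOn fun _ h => h,
    fun p hp => ?_⟩
  rw [differential_comp_proj ((hf.contMDiffAt (hO.mem_nhds hp)).mdifferentiableAt (by simp)),
    hS, haf _ hp]

theorem isConservativeOn_univ_iff : S.IsConservativeOn univ ↔ S.IsConservative := by
  refine exists_congr fun U => and_congr ?_
    ⟨fun h => funext fun p => h p (mem_univ _), fun h p _ => congrFun h p⟩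
  exact contMDiffOn_univ

theorem IsConservative.isLocallyConservative (h : S.IsConservative) : S.IsLocallyConservative :=
  fun x => ⟨univ, isOpen_univ, mem_univ x, isConservativeOn_univ_iff.2 h⟩

/-- The zero section pulls `π^* a` back to `a`, so the restriction of `U` to it is a potential on
the base. -/
theorem IsConservativeOn.exists_eq_differential (hO : IsOpen O)
    (hS : ∀ p, S.work p = (a p.proj).comp (projDeriv p)) (h : S.IsConservativeOn O) :
    ∃ f : M → ℝ, ContMDiffOn 𝓘(ℝ, E) 𝓘(ℝ, ℝ) ∞ f O ∧
      ∀ x ∈ O, a x = differential 𝓘(ℝ, E) f x := by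
  obtain ⟨U, hU, hUS⟩ := h
  refine ⟨fun x => U (toSection 0 x), hU.comp contMDiff_toSection_zero.contMDiffOn fun _ h => h,
    fun x hx => ContinuousLinearMap.ext fun v => ?_⟩
  have hX := (contMDiff_toSection_zero (E := E) (M := M)).mdifferentiable (by simp) x
  have hopen : IsOpen {p : TM E M | p.proj ∈ O} := hO.preimage contMDiff_tangent_proj.continuous
  rw [mfderiv_comp_toSection ((hU.contMDiffAt (hopen.mem_nhds hx)).mdifferentiableAt (by simp)) hX,
    ← hUS _ hx, hS]
  exact congrArg (a x) (projDeriv_sectionDeriv hX v).symm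

section LagrangianIntegral

variable [FiniteDimensional ℝ E]

/-- Newton's equation pulled back by the section; both directions of the theorem are read off from
it. -/
theorem differential_kineticEnergy_toSection_eq
    (hX : MDifferentiableAt 𝓘(ℝ, E) (JT E) (toSection X) x)
    (hS : ∀ p, S.work p = (a p.proj).comp (projDeriv p)) {D : (p : TM E M) → TangentSpace (JT E) p}
    (hD : S.IsEquationOfMotion D) (v : TangentSpace 𝓘(ℝ, E) x) :
    S.metric.symplecticForm (toSection X x) (D (toSection X x)) (sectionDeriv X x v) +
      differential 𝓘(ℝ, E) (fun x => S.metric.kineticEnergy (toSection X x)) x v + a x v = 0 := by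
  have h := hD.2 (toSection X x) (sectionDeriv X x v)
  have h1 := mfderiv_comp_toSection
    ((PseudoRiemannianMetric.contMDiff_kineticEnergy (g := S.metric)).mdifferentiable (by simp) _)
    hX v
  have h2 : S.work (toSection X x) (sectionDeriv X x v) = a x v := by
    rw [hS]
    exact congrArg (a x) (projDeriv_sectionDeriv hX v)
  rw [h1, ← h2]
  exact h

/-- Along a Lagrangian intermediate integral `X` the work form is the differential of `-T ∘ X`. -/
theorem IsLagrangianOn.exists_eq_differential (hS : ∀ p, S.work p = (a p.proj).comp (projDeriv p))
    (hL : S.IsLagrangianOn O X) (hX : S.IsIntermediateIntegralOn O X) :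
    ∃ f : M → ℝ, ContMDiffOn 𝓘(ℝ, E) 𝓘(ℝ, ℝ) ∞ f O ∧
      ∀ x ∈ O, a x = differential 𝓘(ℝ, E) f x := by
  obtain ⟨hO, hsm, D, hD, hT⟩ := hX
  have hK : ContMDiffOn 𝓘(ℝ, E) 𝓘(ℝ, ℝ) ∞ (fun x => S.metric.kineticEnergy (toSection X x)) O :=
    PseudoRiemannianMetric.contMDiff_kineticEnergy.comp_contMDiffOn hsm
  refine ⟨fun x => -S.metric.kineticEnergy (toSection X x), hK.neg, fun x hx => ?_⟩
  refine ContinuousLinearMap.ext fun v => ?_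
  have hXd := (hsm.contMDiffAt (hO.mem_nhds hx)).mdifferentiableAt (by simp)
  have h := differential_kineticEnergy_toSection_eq hXd hS hD v
  -- Tangency puts `D` in the tangent space of the section, where the symplectic form vanishes.
  obtain ⟨w, hw⟩ := hT x hx
  rw [← hw, hL x hx] at h
  have h1 : differential 𝓘(ℝ, E) (fun x => -S.metric.kineticEnergy (toSection X x)) x v =
      -differential 𝓘(ℝ, E) (fun x => S.metric.kineticEnergy (toSection X x)) x v :=
    DFunLike.congr_fun (mfderiv_neg (f := fun x => S.metric.kineticEnergy (toSection X x))
      (x := x)) v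
  rw [h1]
  linarith

/-- As `D` projects to `X`, the only candidate for a tangent vector sent to `D` is `X x`. The
difference of its image and `D` is vertical; it is orthogonal to the section by the Lagrangian
condition and the pulled-back Newton equation, so it vanishes. -/
theorem IsLagrangianOn.isIntermediateIntegralOn (hO : IsOpen O) (ha : a.IsSmooth 𝓘(ℝ, E))
    (hS : ∀ p, S.work p = (a p.proj).comp (projDeriv p)) (hL : S.IsLagrangianOn O X)
    (hX : ContMDiffOn 𝓘(ℝ, E) (JT E) ∞ (toSection X) O)
    (h : ∀ x ∈ O, ∀ v, differential 𝓘(ℝ, E) (fun x => S.metric.kineticEnergy (toSection X x)) x v +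
      a x v = 0) : S.IsIntermediateIntegralOn O X := by
  obtain ⟨D, hD⟩ := S.exists_isEquationOfMotion ha hS
  refine ⟨hO, hX, D, hD, fun x hx => ⟨X x, ?_⟩⟩
  have hXd := (hX.contMDiffAt (hO.mem_nhds hx)).mdifferentiableAt (by simp)
  refine sub_eq_zero.1 (PseudoRiemannianMetric.eq_zero_of_vertical (g := S.metric) ?_ fun v =>
    ⟨sectionDeriv X x v, projDeriv_sectionDeriv hXd v, ?_⟩)
  · rw [map_sub, projDeriv_sectionDeriv hXd, hD.1.2]
    exact sub_self _
  · have h1 : ∀ v : TangentSpace 𝓘(ℝ, E) x, S.metric.symplecticForm (toSection X x)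
        (sectionDeriv X x (X x) - D (toSection X x)) (sectionDeriv X x v) = 0 := fun v => by
      rw [PseudoRiemannianMetric.symplecticForm_sub_left, hL x hx]
      linarith [h x hx v, differential_kineticEnergy_toSection_eq hXd hS hD v]
    exact h1 v

end LagrangianIntegral

end MechanicalSystem

/-- A 1-form which is locally exact is closed. -/
theorem extDeriv_eq_zero_of_eq_differential {a : OneForm 𝓘(ℝ, E) (N := M)} (hO : IsOpen O)
    (hx : x ∈ O) {f : M → ℝ} (hf : ContMDiffOn 𝓘(ℝ, E) 𝓘(ℝ, ℝ) ∞ f O)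
    (haf : ∀ x ∈ O, a x = differential 𝓘(ℝ, E) f x) (ξ η : TangentSpace 𝓘(ℝ, E) x) :
    a.extDeriv 𝓘(ℝ, E) x ξ η = 0 := by
  have hx0 : (extChartAt 𝓘(ℝ, E) x).symm (extChartAt 𝓘(ℝ, E) x x) ∈ O := by
    rwa [extChartAt_to_inv]
  have hc : ContMDiffAt 𝓘(ℝ, E) 𝓘(ℝ, E) ∞ (extChartAt 𝓘(ℝ, E) x).symm (extChartAt 𝓘(ℝ, E) x x) :=
    contMDiffAt_extChartAt_symm (mem_extChartAt_target x)
  have hu : ContDiffAt ℝ ∞ (fun y => f ((extChartAt 𝓘(ℝ, E) x).symm y)) (extChartAt 𝓘(ℝ, E) x x) :=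
    ((hf.contMDiffAt (hO.mem_nhds hx0)).comp _ hc).contDiffAt
  have h : a.inChart 𝓘(ℝ, E) x =ᶠ[𝓝 (extChartAt 𝓘(ℝ, E) x x)]
      fderiv ℝ (fun y => f ((extChartAt 𝓘(ℝ, E) x).symm y)) := by
    filter_upwards [(isOpen_extChartAt_target x).mem_nhds (mem_extChartAt_target x),
      hc.continuousAt.eventually (hO.mem_nhds hx0)] with y hy hyO
    rw [← mfderiv_eq_fderiv]
    refine Eq.trans ?_ (mfderiv_comp y
      ((hf.contMDiffAt (hO.mem_nhds hyO)).mdifferentiableAt (by simp))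
      (mdifferentiableAt_extChartAt_symm hy)).symm
    rw [OneForm.inChart, haf _ hyO]
    rfl
  have hsymm : IsSymmSndFDerivAt ℝ (fun y => f ((extChartAt 𝓘(ℝ, E) x).symm y))
      (extChartAt 𝓘(ℝ, E) x x) :=
    hu.isSymmSndFDerivAt (by rw [minSmoothness_of_isRCLikeNormedField]; exact ENat.LEInfty.out)
  unfold OneForm.extDeriv
  rw [h.fderiv_eq]
  exact sub_eq_zero.2 (hsymm _ _)

end Conservative

/-! ### From a local potential to a Lagrangian intermediate integral. -/

section HamiltonJacobi

variable {E : Type v} [NormedAddCommGroup E] [NormedSpace ℝ E] [FiniteDimensional ℝ E]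
  {M : Type u} [TopologicalSpace M] [ChartedSpace E M] [IsManifold 𝓘(ℝ, E) ∞ M]

set_option synthInstance.maxHeartbeats 400000 in
/-- The Hamilton–Jacobi equation `½ g⁻¹(dS, dS) + f = const` has a local solution in the preferred
chart. -/
theorem PseudoRiemannianMetric.exists_local_solution_hamiltonJacobi [Nontrivial E]
    (g : PseudoRiemannianMetric E M) {c : M} {y₀ : E} (hy₀ : y₀ ∈ (extChartAt 𝓘(ℝ, E) c).target)
    {f : E → ℝ} (hf : ∀ᶠ y in 𝓝 y₀, ContDiffAt ℝ ∞ f y) :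
    ∃ (S : E → ℝ) (k : ℝ), ∀ᶠ y in 𝓝 y₀, ContDiffAt ℝ ∞ S y ∧
      (1 / 2 : ℝ) * fderiv ℝ S y ((g.inChart c y).inverse (fderiv ℝ S y)) + f y = k := by
  have := FiniteDimensional.complete ℝ E
  -- The energy level is free, so the initial momentum may be taken as `g e` with `e ≠ 0`. Its
  -- velocity is `e`, which gives the nonvanishing required by the method of characteristics.
  obtain ⟨e, he⟩ := exists_ne (0 : E)
  have hev : ∀ᶠ z : E × (E →L[ℝ] ℝ) in 𝓝 (y₀, g.inChart c y₀ e),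
      z.1 ∈ (extChartAt 𝓘(ℝ, E) c).target ∧ ContDiffAt ℝ ∞ f z.1 :=
    continuousAt_fst.eventually
      (Filter.Eventually.and ((isOpen_extChartAt_target c).mem_nhds hy₀) hf)
  have hB : ∀ z : E × (E →L[ℝ] ℝ), z.1 ∈ (extChartAt 𝓘(ℝ, E) c).target →
      ContDiffAt ℝ ∞ (fun z : E × (E →L[ℝ] ℝ) => (g.inChart c z.1).inverse) z := fun z hz =>
    ContDiffAt.comp (g := ContinuousLinearMap.inverse) z
      (g.isInvertible_inChart hz).contDiffAt_map_inverse
      (ContDiffAt.comp (g := g.inChart c) z (g.contDiffAt_inChart hz) contDiffAt_fst)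
  have hV : ∀ z : E × (E →L[ℝ] ℝ), z.1 ∈ (extChartAt 𝓘(ℝ, E) c).target →
      ContDiffAt ℝ ∞ (fun z : E × (E →L[ℝ] ℝ) => (g.inChart c z.1).inverse z.2) z := fun z hz =>
    (hB z hz).clm_apply contDiffAt_snd
  obtain ⟨S, hS⟩ := Mechanics.exists_local_solution_hamiltonJacobi
    (H := fun z => (1 / 2 : ℝ) * z.2 ((g.inChart c z.1).inverse z.2) + f z.1)
    (V := fun z => (g.inChart c z.1).inverse z.2) (x₀ := y₀) (p₀ := g.inChart c y₀ e)
    (hev.mono fun z hz => (contDiffAt_const.mul (contDiffAt_snd.clm_apply (hV z hz.1))).add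
      (ContDiffAt.comp (g := f) z hz.2 contDiffAt_fst))
    (hev.mono fun z hz => hV z hz.1)
    (hev.mono fun z hz q => by
      have h1 := ((hB z hz.1).differentiableAt (by simp)).hasFDerivAt.clm_apply
        (hasFDerivAt_snd (𝕜 := ℝ) (p := z))
      have h2 := ((hasFDerivAt_snd (𝕜 := ℝ) (p := z)).clm_apply h1).const_mul (1 / 2 : ℝ)
      have h3 : HasFDerivAt (fun z : E × (E →L[ℝ] ℝ) => f z.1) _ z :=
        HasFDerivAt.comp (g := f) z (hz.2.differentiableAt (by simp)).hasFDerivAt hasFDerivAt_fst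
      have h4 := h2.add h3
      have h5 : fderiv ℝ (fun z : E × (E →L[ℝ] ℝ) => (g.inChart c z.1).inverse) z (0, q) = 0 := by
        have h6 : HasFDerivAt (fun z : E × (E →L[ℝ] ℝ) => (g.inChart c z.1).inverse) _ z :=
          HasFDerivAt.comp (g := fun y => (g.inChart c y).inverse) z
            ((ContDiffAt.comp (g := ContinuousLinearMap.inverse) z.1
              (g.isInvertible_inChart hz.1).contDiffAt_map_inverse
              (g.contDiffAt_inChart hz.1)).differentiableAt (by simp)).hasFDerivAt hasFDerivAt_fst
        rw [h6.fderiv]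
        exact ContinuousLinearMap.map_zero (fderiv ℝ (fun y => (g.inChart c y).inverse) z.1)
      -- The inverse metric is symmetric, so the two halves of the derivative of the quadratic term
      -- in the momentum agree.
      have h7 : z.2 ((g.inChart c z.1).inverse q) = q ((g.inChart c z.1).inverse z.2) := by
        have i1 := (g.isInvertible_inChart hz.1).self_apply_inverse z.2
        have i2 := (g.isInvertible_inChart hz.1).self_apply_inverse q
        calc z.2 ((g.inChart c z.1).inverse q)
            = g.inChart c z.1 ((g.inChart c z.1).inverse z.2) ((g.inChart c z.1).inverse q) := by
              rw [i1]
          _ = g.inChart c z.1 ((g.inChart c z.1).inverse q) ((g.inChart c z.1).inverse z.2) :=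
              g.inChart_symm c z.1 _ _
          _ = _ := by rw [i2]
      refine (DFunLike.congr_fun h4.fderiv (0, q)).trans ?_
      simp [h5, h7]
      ring)
    (by
      dsimp only
      rw [(g.isInvertible_inChart hy₀).inverse_apply_self]
      exact he)
  exact ⟨S, _, hS⟩

namespace MechanicalSystem

variable {S : MechanicalSystem E M} {a : OneForm 𝓘(ℝ, E) (N := M)} {O : Set M}

/-- In dimension zero no nonzero initial momentum exists, but every tangent vector vanishes and the
zero field serves. -/
theorem isLagrangianOn_zero_of_subsingleton [Subsingleton E] (ha : a.IsSmooth 𝓘(ℝ, E))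
    (hS : ∀ p, S.work p = (a p.proj).comp (projDeriv p)) :
    S.IsIntermediateIntegralOn univ (0 : (x : M) → TangentSpace 𝓘(ℝ, E) x) ∧
      S.IsLagrangianOn univ (0 : (x : M) → TangentSpace 𝓘(ℝ, E) x) := by
  have hzero : ∀ (x : M) (v : TangentSpace 𝓘(ℝ, E) x), v = 0 := fun x v =>
    Subsingleton.elim (α := E) _ _
  have hL : S.IsLagrangianOn univ (0 : (x : M) → TangentSpace 𝓘(ℝ, E) x) := by
    intro x _ v w
    rw [hzero x v, hzero x w]
    exact sub_self _
  refine ⟨hL.isIntermediateIntegralOn isOpen_univ ha hS contMDiff_toSection_zero.contMDiffOn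
    fun x _ v => ?_, hL⟩
  rw [hzero x v, map_zero, map_zero, add_zero]

/-- If the work form is locally the differential of `f`, the gradients of the solutions of the
Hamilton–Jacobi equation are Lagrangian intermediate integrals. -/
theorem exists_isLagrangianOn_of_eq_differential (hO : IsOpen O) {x₀ : M} (hx₀ : x₀ ∈ O)
    (ha : a.IsSmooth 𝓘(ℝ, E)) (hS : ∀ p, S.work p = (a p.proj).comp (projDeriv p)) {f : M → ℝ}
    (hf : ContMDiffOn 𝓘(ℝ, E) 𝓘(ℝ, ℝ) ∞ f O) (haf : ∀ x ∈ O, a x = differential 𝓘(ℝ, E) f x) :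
    ∃ (O' : Set M) (X : (x : M) → TangentSpace 𝓘(ℝ, E) x), x₀ ∈ O' ∧
      S.IsIntermediateIntegralOn O' X ∧ S.IsLagrangianOn O' X := by
  have := FiniteDimensional.complete ℝ E
  cases subsingleton_or_nontrivial E with
  | inl h => exact ⟨univ, 0, mem_univ _, isLagrangianOn_zero_of_subsingleton ha hS⟩
  | inr h =>
  set φ := extChartAt 𝓘(ℝ, E) x₀ with hφ
  have hy₀ : φ x₀ ∈ φ.target := mem_extChartAt_target x₀
  have hopen : IsOpen φ.target := isOpen_extChartAt_target x₀
  have hev : ∀ᶠ y in 𝓝 (φ x₀), y ∈ φ.target ∧ φ.symm y ∈ O := by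
    have hx₁ : φ.symm (φ x₀) ∈ O := by rwa [extChartAt_to_inv x₀]
    exact Filter.Eventually.and (hopen.mem_nhds hy₀) ((contMDiffAt_extChartAt_symm (I := 𝓘(ℝ, E))
      hy₀).continuousAt.eventually (hO.mem_nhds hx₁))
  obtain ⟨u, k, hu⟩ := S.metric.exists_local_solution_hamiltonJacobi hy₀
    (f := fun y => f (φ.symm y)) (hev.mono fun y hy =>
      ((hf.contMDiffAt (hO.mem_nhds hy.2)).comp y (contMDiffAt_extChartAt_symm hy.1)).contDiffAt)
  obtain ⟨t, ht, hto, hyt⟩ := eventually_nhds_iff.1 (hev.and hu)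
  -- The coordinate expression of the gradient of `u`.
  set W : E → E := fun y => (S.metric.inChart x₀ y).inverse (fderiv ℝ u y) with hW
  have hWs : ∀ y ∈ t, ContDiffAt ℝ ∞ W y := fun y hy =>
    ContDiffAt.clm_apply (ContDiffAt.comp (g := ContinuousLinearMap.inverse) y
      (S.metric.isInvertible_inChart (ht y hy).1.1).contDiffAt_map_inverse
      (S.metric.contDiffAt_inChart (ht y hy).1.1)) (contDiffAt_fderiv_infty (ht y hy).2.1)
  have hGW : ∀ y ∈ t, S.metric.inChart x₀ y (W y) = fderiv ℝ u y := fun y hy =>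
    (S.metric.isInvertible_inChart (ht y hy).1.1).self_apply_inverse _
  set X : (x : M) → TangentSpace 𝓘(ℝ, E) x := coordField 𝓘(ℝ, E) x₀ W with hX
  have hXW : ∀ y ∈ t, X (φ.symm y) =
      mfderiv 𝓘(ℝ, E) 𝓘(ℝ, E) φ.symm y (W y) := by
    intro y hy
    rw [hX]
    unfold coordField
    rw [← hφ, φ.right_inv (ht y hy).1.1]
  have hO' : IsOpen (φ.source ∩ φ ⁻¹' t) :=
    (continuousOn_extChartAt x₀).isOpen_inter_preimage (isOpen_extChartAt_source x₀) hto
  have hmem : ∀ x ∈ φ.source ∩ φ ⁻¹' t, ∃ y ∈ t, φ.symm y = x := fun x hx =>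
    ⟨φ x, hx.2, φ.left_inv hx.1⟩
  have hmem' : ∀ y ∈ t, φ.symm y ∈ φ.source ∩ φ ⁻¹' t := fun y hy =>
    ⟨φ.map_target (ht y hy).1.1, by rwa [mem_preimage, φ.right_inv (ht y hy).1.1]⟩
  have hXs : ∀ x ∈ φ.source ∩ φ ⁻¹' t, ContMDiffAt 𝓘(ℝ, E) (JT E) ∞ (toSection X) x :=
    fun x hx => contMDiffAt_coordField hx.1 (hWs _ hx.2)
  have hσ : ∀ y ∈ t, ContMDiffAt 𝓘(ℝ, E) (JT E) ∞ (fun y => toSection X (φ.symm y)) y :=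
    fun y hy => (hXs _ (hmem' y hy)).comp y (contMDiffAt_extChartAt_symm (ht y hy).1.1)
  have hσd : ∀ y ∈ t, ∀ w, mfderiv 𝓘(ℝ, E) (JT E) (fun y => toSection X (φ.symm y)) y w =
      sectionDeriv X (φ.symm y) (mfderiv 𝓘(ℝ, E) 𝓘(ℝ, E) φ.symm y w) := fun y hy =>
    DFunLike.congr_fun (mfderiv_comp y ((hXs _ (hmem' y hy)).mdifferentiableAt (by simp))
      (mdifferentiableAt_extChartAt_symm (ht y hy).1.1))
  -- The section pulls the Liouville form back to `du`, so the Lagrangian condition becomes symmetry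
  -- of second derivatives.
  have hpull : ∀ y ∈ t, S.metric.liouville.pullback (JT E) (fun y => toSection X (φ.symm y)) y =
      fderiv ℝ u y := by
    intro y hy
    refine ContinuousLinearMap.ext fun w => ?_
    rw [← hGW y hy]
    change S.metric.form (φ.symm y) (X (φ.symm y)) (projDeriv (toSection X (φ.symm y))
      (mfderiv 𝓘(ℝ, E) (JT E) (fun y => toSection X (φ.symm y)) y w)) = _
    have h1 := (congrArg (projDeriv (toSection X (φ.symm y))) (hσd y hy w)).trans
      (projDeriv_sectionDeriv ((hXs _ (hmem' y hy)).mdifferentiableAt (by simp)) _)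
    rw [hXW y hy]
    exact congrArg (S.metric.form (φ.symm y) (mfderiv 𝓘(ℝ, E) 𝓘(ℝ, E) φ.symm y (W y))) h1
  have hL : S.IsLagrangianOn (φ.source ∩ φ ⁻¹' t) X := by
    intro x hx v w
    obtain ⟨y, hy, rfl⟩ := hmem x hx
    obtain ⟨v, rfl⟩ := exists_mfderiv_extChartAt_symm_eq (ht y hy).1.1 v
    obtain ⟨w, rfl⟩ := exists_mfderiv_extChartAt_symm_eq (ht y hy).1.1 w
    refine (congrArg₂ (S.metric.symplecticForm _) (hσd y hy v).symm (hσd y hy w).symm).trans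
      ((PseudoRiemannianMetric.symplecticForm_mfderiv (hσ y hy) v w).trans ?_)
    have h1 : S.metric.liouville.pullback (JT E) (fun y => toSection X (φ.symm y)) =ᶠ[𝓝 y]
        fderiv ℝ u := by
      filter_upwards [hto.mem_nhds hy] with y' hy' using hpull y' hy'
    rw [h1.fderiv_eq]
    exact sub_eq_zero.2 ((ht y hy).2.1.isSymmSndFDerivAt
      (by rw [minSmoothness_of_isRCLikeNormedField]; exact ENat.LEInfty.out) v w)
  have hK : ∀ x ∈ φ.source ∩ φ ⁻¹' t, S.metric.kineticEnergy (toSection X x) = -f x + k := by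
    intro x hx
    obtain ⟨y, hy, rfl⟩ := hmem x hx
    have h1 : S.metric.kineticEnergy (toSection X (φ.symm y)) =
        (1 / 2 : ℝ) * S.metric.inChart x₀ y (W y) (W y) := by
      change (1 / 2 : ℝ) * S.metric.form (φ.symm y) (X (φ.symm y)) (X (φ.symm y)) = _
      rw [hXW y hy]
      rfl
    rw [h1, hGW y hy, ← (ht y hy).2.2]
    ring
  refine ⟨φ.source ∩ φ ⁻¹' t, X, ⟨mem_extChartAt_source x₀, hyt⟩,
    hL.isIntermediateIntegralOn hO' ha hS (fun x hx => (hXs x hx).contMDiffWithinAt)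
      fun x hx v => ?_, hL⟩
  have hxO : x ∈ O := by
    obtain ⟨y, hy, rfl⟩ := hmem x hx
    exact (ht y hy).1.2
  have h1 : (fun x => S.metric.kineticEnergy (toSection X x)) =ᶠ[𝓝 x] fun x => -f x + k := by
    filter_upwards [hO'.mem_nhds hx] with x' hx' using hK x' hx'
  have hfd := ((hf.contMDiffAt (hO.mem_nhds hxO)).mdifferentiableAt (by simp)).hasMFDerivAt
  have h2 := (h1.mfderiv_eq.trans (hfd.neg.add (hasMFDerivAt_const k x)).mfderiv)
  have h3 : differential 𝓘(ℝ, E) (fun x => S.metric.kineticEnergy (toSection X x)) x v =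
      -differential 𝓘(ℝ, E) f x v := (DFunLike.congr_fun h2 v).trans (add_zero _)
  rw [h3, haf x hxO]
  exact neg_add_cancel _

theorem IsLocallyConservative.admitsLagrangianIntermediateIntegrals (ha : a.IsSmooth 𝓘(ℝ, E))
    (hS : ∀ p, S.work p = (a p.proj).comp (projDeriv p)) (h : S.IsLocallyConservative) :
    S.AdmitsLagrangianIntermediateIntegrals := by
  have key : ∀ x : M, ∃ (O : Set M) (X : (x : M) → TangentSpace 𝓘(ℝ, E) x), x ∈ O ∧
      S.IsIntermediateIntegralOn O X ∧ S.IsLagrangianOn O X := fun x => by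
    obtain ⟨O, hO, hx, hc⟩ := h x
    obtain ⟨f, hf, haf⟩ := hc.exists_eq_differential hO hS
    exact exists_isLagrangianOn_of_eq_differential hO hx ha hS hf haf
  choose O X hx hX using key
  -- One integral is chosen for each point; the index type `M` lies in the required universe.
  exact ⟨M, O, X, eq_univ_of_forall fun x => mem_iUnion.2 ⟨x, hx x⟩, hX⟩

theorem AdmitsLagrangianIntermediateIntegrals.exists_eq_differential
    (hS : ∀ p, S.work p = (a p.proj).comp (projDeriv p))
    (h : S.AdmitsLagrangianIntermediateIntegrals) (x : M) :
    ∃ (O : Set M) (f : M → ℝ), IsOpen O ∧ x ∈ O ∧ ContMDiffOn 𝓘(ℝ, E) 𝓘(ℝ, ℝ) ∞ f O ∧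
      ∀ x ∈ O, a x = differential 𝓘(ℝ, E) f x := by
  obtain ⟨ι, O, X, hcov, hX⟩ := h
  obtain ⟨i, hi⟩ := mem_iUnion.1 (hcov.symm ▸ mem_univ x : x ∈ ⋃ i, O i)
  obtain ⟨f, hf, haf⟩ := (hX i).2.exists_eq_differential hS (hX i).1
  exact ⟨O i, f, (hX i).1.1, hi, hf, haf⟩

end MechanicalSystem

end HamiltonJacobi
end Mechanics

/-! ### The four statements. -/

theorem mainTheorem3 {E : Type v} [NormedAddCommGroup E] [NormedSpace ℝ E] [FiniteDimensional ℝ E]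
    {M : Type u} [TopologicalSpace M] [T2Space M] [SecondCountableTopology M]
    [ChartedSpace E M] [IsManifold 𝓘(ℝ, E) ∞ M]
    (S : Mechanics.MechanicalSystem E M) (hS : S.VelocityIndependent) :
    (S.IsLocallyConservative ↔ S.AdmitsLagrangianIntermediateIntegrals) ∧
    (S.IsConservative → S.AdmitsLagrangianIntermediateIntegrals) ∧
    (Mechanics.FirstDeRhamCohomologyVanishes 𝓘(ℝ, E) M →
      (S.IsConservative ↔ S.AdmitsLagrangianIntermediateIntegrals)) ∧
    (∀ X : (x : M) → TangentSpace 𝓘(ℝ, E) x,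
      S.IsIntermediateIntegralOn univ X → S.IsLagrangianOn univ X → S.IsConservative) := by
  obtain ⟨a, ha, haS⟩ := hS
  have hloc : S.IsLocallyConservative → S.AdmitsLagrangianIntermediateIntegrals := fun h =>
    h.admitsLagrangianIntermediateIntegrals ha haS
  refine ⟨⟨hloc, fun h x => ?_⟩, fun h => hloc h.isLocallyConservative,
    fun hH => ⟨fun h => hloc h.isLocallyConservative, fun h => ?_⟩, fun X hX hL => ?_⟩
  · obtain ⟨O, f, hO, hx, hf, haf⟩ := h.exists_eq_differential haS x
    exact ⟨O, hO, hx, Mechanics.MechanicalSystem.isConservativeOn_of_eq_differential hO haS hf haf⟩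
  -- The local potentials need not glue, as they may differ by constants on overlaps. They do show
  -- that `a` is closed, and the vanishing of cohomology then gives a global potential.
  · obtain ⟨f, hf, haf⟩ := hH a ha fun x ξ η => by
      obtain ⟨O, f, hO, hx, hf, haf⟩ := h.exists_eq_differential haS x
      exact Mechanics.extDeriv_eq_zero_of_eq_differential hO hx hf haf ξ η
    exact Mechanics.MechanicalSystem.isConservativeOn_univ_iff.1
      (Mechanics.MechanicalSystem.isConservativeOn_of_eq_differential isOpen_univ haS
        hf.contMDiffOn fun x _ => congrFun haf x)
  · obtain ⟨f, hf, haf⟩ := hL.exists_eq_differential haS hX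
    exact Mechanics.MechanicalSystem.isConservativeOn_univ_iff.1
      (Mechanics.MechanicalSystem.isConservativeOn_of_eq_differential isOpen_univ haS hf haf)
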